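/- Let $0<R_{\rm id}<R_{\rm d}$, let $\Omega=\{(x,y):R_{\rm id}^2<x^2+y^2<R_{\rm d}^2\}$, with inner boundary circle $\Gamma_{\rm id}$ (radius $R_{\rm id}$) and outer boundary circle $\Gamma_{\rm d}$ (radius $R_{\rm d}$), and let $n$ be the outward unit normal. All functions are real valued. Let $(\overline u,\overline q)\in H^{1/2}(\Gamma_{\rm d})\times H^{-1/2}(\Gamma_{\rm d})$ be Cauchy data of a harmonic function: there is a weakly harmonic $v\in H^1(\Omega)$, with some trace in $H^{1/2}(\Gamma_{\rm id})$ on $\Gamma_{\rm id}$, such that $v=\overline u$ and $\partial v/\partial n=\overline q$ on $\Gamma_{\rm d}$. For $\omega\in H^{1/2}(\Gamma_{\rm id})$ let $v(\omega)\in H^1(\Omega)$ be the weak solution of $-\Delta v=0$ in $\Omega$, $\partial v/\partial n=\overline q$ on $\Gamma_{\rm d}$, $v=\omega$ on $\Gamma_{\rm id}$, and put $$J(\omega)=\int_{\Gamma_{\rm d}}|v(\omega)-\overline u|^2\,d\Gamma .$$ Let $\omega^*\in H^{1/2}(\Gamma_{\rm id})$ satisfy $J(\omega^*)=\inf_{\omega\in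 H^{1/2}(\Gamma_{\rm id})}J(\omega)$ (the exact boundary value). Let $J'(\omega)$ be the first variation, $J(\omega+\delta\omega)-J(\omega)=(J'(\omega),\delta\omega)+o(\|\delta\omega\|)$ for $\delta\omega \in H^{1/2}(\Gamma_{\rm id})$, with the inner product and norm of $L^2(\Gamma_{\rm id})$; or let it be computed by the adjoint method as $J'(\omega)=-\partial\widehat v/\partial n|_{\Gamma_{\rm id}}$, where $\widehat v$ is the weak solution of $-\Delta\widehat v=0$ in $\Omega$, $\partial\widehat v/\partial n=2(v(\omega)-\overline u)$ on $\Gamma_{\rm d}$, $\widehat v=0$ on $\Gamma_{\rm id}$. Let $(\omega_k)\subset H^{1/2}(\Gamma_{\rm id})$ satisfy $\omega_{k+1}=\omega_k-\rho_kJ'(\omega_k)$ for $k=0,1,\dots,N-M$, where $N\ge M\ge 0$ are integers, and put $\mu_k=\omega^*-\omega_k$. Assume that the initial error is a finite Fourier series $$\mu_0=\sum_{M\le|j|\le N}a_je^{ij\theta},\qquad a_j\in\mathbb C,$$ and let $$C_j=\frac{8R_{\rm d}^{2|j|+1}R_{\rm id}^{2|j|-1}}{\left(R_{\rm id}^{2|j|}+R_{\rm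 d}^{2|j|}\right)^2}.$$ If either $\rho_k=1/C_{M+k}$ for all $k=0,1,\dots,N-M$, or $\rho_k=1/C_{N-k}$ for all $k=0,1,\dots,N-M$, then $\mu_{N-M+1}=0$, that is, $\omega_{N-M+1}=\omega^*$: the exact boundary value is reached after $N-M+1$ iterations. -/

import Mathlib

open MeasureTheory Filter Topology
open scoped ENNReal

namespace AnnulusCauchy

noncomputable section

/-- The plane, with Lebesgue measure `volume`. Only the coordinates are used below, never the
norm of the product. -/
abbrev Plane : Type := ℝ × ℝ

/-- The annulus `{a² < x² + y² < b²}`. -/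
def annulus (a b : ℝ) : Set Plane :=
  {p | a ^ 2 < p.1 ^ 2 + p.2 ^ 2 ∧ p.1 ^ 2 + p.2 ^ 2 < b ^ 2}

/-- The point of the circle of radius `R` about the origin at polar angle `θ`. -/
def circlePoint (R θ : ℝ) : Plane := (R * Real.cos θ, R * Real.sin θ)

/-- Arc length on the circle of radius `R`, as a measure on the plane: the image of `R dθ`. -/
def arcMeasure (R : ℝ) : Measure Plane :=
  Measure.map (circlePoint R)
    (ENNReal.ofReal R • volume.restrict (Set.Ioc (-Real.pi) Real.pi))

/-- Real `L²` over a measure on the plane. -/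
abbrev L2 (m : Measure Plane) : Type := Lp ℝ 2 m

/-- Triples `(v, v₁, v₂)` of `L²(Ω)` functions: a function with candidates for its two partial
derivatives. -/
abbrev Jet (Ω : Set Plane) : Type :=
  L2 (volume.restrict Ω) × L2 (volume.restrict Ω) × L2 (volume.restrict Ω)

/-- `g` is the weak derivative of `f` on `Ω` in the direction `e`. -/
def IsWeakDeriv (Ω : Set Plane) (e : Plane) (f g : L2 (volume.restrict Ω)) : Prop :=
  ∀ φ : Plane → ℝ, ContDiff ℝ (⊤ : ℕ∞) φ → HasCompactSupport φ → tsupport φ ⊆ Ω →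
    ∫ p in Ω, f p * fderiv ℝ φ p e = -∫ p in Ω, g p * φ p

theorem memLp_test {Ω : Set Plane} {φ : Plane → ℝ} (h : ContDiff ℝ (⊤ : ℕ∞) φ)
    (hc : HasCompactSupport φ) : MemLp φ 2 (volume.restrict Ω) :=
  (h.continuous.memLp_of_hasCompactSupport hc)

theorem memLp_test_deriv {Ω : Set Plane} {φ : Plane → ℝ} (e : Plane) (h : ContDiff ℝ (⊤ : ℕ∞) φ)
    (hc : HasCompactSupport φ) : MemLp (fun p => fderiv ℝ φ p e) 2 (volume.restrict Ω) := by
  have h1 : Continuous (fun p => fderiv ℝ φ p e) :=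
    (h.continuous_fderiv (by simp)).clm_apply continuous_const
  exact h1.memLp_of_hasCompactSupport (hc.fderiv_apply (𝕜 := ℝ) e)

theorem IsWeakDeriv.zero (Ω : Set Plane) (e : Plane) : IsWeakDeriv Ω e 0 0 := by
  intro φ _ _ _
  have h0 := Lp.coeFn_zero ℝ 2 (volume.restrict Ω)
  have h1 : ∀ ψ : Plane → ℝ, ∫ p in Ω, (0 : L2 (volume.restrict Ω)) p * ψ p = 0 := by
    intro ψ
    refine integral_eq_zero_of_ae ?_
    filter_upwards [h0] with p hp
    rw [hp, Pi.zero_apply, zero_mul]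
  rw [h1 (fun p => fderiv ℝ φ p e), h1 φ, neg_zero]

theorem integral_add_mul {m : Measure Plane} (f g : L2 m) {ψ : Plane → ℝ} (hψ : MemLp ψ 2 m) :
    ∫ p, (f + g : L2 m) p * ψ p ∂m = ∫ p, f p * ψ p ∂m + ∫ p, g p * ψ p ∂m := by
  have e := integral_add ((Lp.memLp f).integrable_mul hψ) ((Lp.memLp g).integrable_mul hψ)
  refine Eq.trans (integral_congr_ae ?_) e
  filter_upwards [Lp.coeFn_add f g] with p hp
  rw [hp, Pi.add_apply, add_mul]
  rfl

theorem integral_smul_mul {m : Measure Plane} (c : ℝ) (f : L2 m) (ψ : Plane → ℝ) :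
    ∫ p, (c • f : L2 m) p * ψ p ∂m = c * ∫ p, f p * ψ p ∂m := by
  rw [← integral_const_mul]
  refine integral_congr_ae ?_
  filter_upwards [Lp.coeFn_smul c f] with p hp
  rw [hp, Pi.smul_apply, smul_eq_mul, mul_assoc]

theorem IsWeakDeriv.add {Ω : Set Plane} {e : Plane} {f g f' g' : L2 (volume.restrict Ω)}
    (h : IsWeakDeriv Ω e f g) (h' : IsWeakDeriv Ω e f' g') :
    IsWeakDeriv Ω e (f + f') (g + g') := by
  intro φ h1 h2 h3
  rw [integral_add_mul _ _ (memLp_test_deriv e h1 h2), integral_add_mul _ _ (memLp_test h1 h2),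
    h φ h1 h2 h3, h' φ h1 h2 h3]
  ring

theorem IsWeakDeriv.smul {Ω : Set Plane} {e : Plane} (c : ℝ) {f g : L2 (volume.restrict Ω)}
    (h : IsWeakDeriv Ω e f g) : IsWeakDeriv Ω e (c • f) (c • g) := by
  intro φ h1 h2 h3
  have e1 := integral_smul_mul c f (fun p => fderiv ℝ φ p e)
  have e2 := integral_smul_mul c g φ
  rw [e1, e2, h φ h1 h2 h3]
  ring

/-- The Sobolev space `H¹(Ω)`: an element is an `L²` function together with its (unique) weak
partial derivatives, which are in `L²`. -/
def H1 (Ω : Set Plane) : Submodule ℝ (Jet Ω) where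
  carrier := {v | IsWeakDeriv Ω (1, 0) v.1 v.2.1 ∧ IsWeakDeriv Ω (0, 1) v.1 v.2.2}
  zero_mem' := ⟨IsWeakDeriv.zero Ω _, IsWeakDeriv.zero Ω _⟩
  add_mem' := fun h h' => ⟨h.1.add h'.1, h.2.add h'.2⟩
  smul_mem' := fun c _ h => ⟨h.1.smul c, h.2.smul c⟩

/-- The `H¹(Ω)` norm. -/
def normH1 {Ω : Set Plane} (v : H1 Ω) : ℝ :=
  Real.sqrt (‖v.1.1‖ ^ 2 + ‖v.1.2.1‖ ^ 2 + ‖v.1.2.2‖ ^ 2)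

/-- The Dirichlet form `∫_Ω ∇v · ∇w`. -/
def dirichletForm {Ω : Set Plane} (v w : H1 Ω) : ℝ :=
  inner ℝ v.1.2.1 w.1.2.1 + inner ℝ v.1.2.2 w.1.2.2

/-- Smooth functions on the closed annulus (restrictions of smooth functions on the plane), listed
with their partial derivatives on the annulus and their restrictions to the inner circle (radius
`a`) and to the outer circle (radius `b`). -/
def smoothGraph (a b : ℝ) :
    Submodule ℝ (Jet (annulus a b) × L2 (arcMeasure a) × L2 (arcMeasure b)) where
  carrier := {x | ∃ w : Plane → ℝ, ContDiff ℝ (⊤ : ℕ∞) w ∧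
    x.1.1 =ᵐ[volume.restrict (annulus a b)] w ∧
    x.1.2.1 =ᵐ[volume.restrict (annulus a b)] (fun p => fderiv ℝ w p (1, 0)) ∧
    x.1.2.2 =ᵐ[volume.restrict (annulus a b)] (fun p => fderiv ℝ w p (0, 1)) ∧
    x.2.1 =ᵐ[arcMeasure a] w ∧
    x.2.2 =ᵐ[arcMeasure b] w}
  zero_mem' := by
    refine ⟨fun _ => 0, contDiff_const, ?_, ?_, ?_, ?_, ?_⟩
    · exact Lp.coeFn_zero ℝ 2 _
    · filter_upwards [Lp.coeFn_zero ℝ 2 (volume.restrict (annulus a b))] with p hp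
      simpa using hp
    · filter_upwards [Lp.coeFn_zero ℝ 2 (volume.restrict (annulus a b))] with p hp
      simpa using hp
    · exact Lp.coeFn_zero ℝ 2 _
    · exact Lp.coeFn_zero ℝ 2 _
  add_mem' := by
    rintro x y ⟨w, hw, h1, h2, h3, h4, h5⟩ ⟨z, hz, k1, k2, k3, k4, k5⟩
    have hd : ∀ p, fderiv ℝ (fun p => w p + z p) p = fderiv ℝ w p + fderiv ℝ z p := fun p =>
      fderiv_fun_add (hw.differentiable (by simp) p) (hz.differentiable (by simp) p)
    refine ⟨fun p => w p + z p, hw.add hz, ?_, ?_, ?_, ?_, ?_⟩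
    · filter_upwards [Lp.coeFn_add x.1.1 y.1.1, h1, k1] with p e e1 e2
      change (x.1.1 + y.1.1 : L2 (volume.restrict (annulus a b))) p = _
      rw [e, Pi.add_apply, e1, e2]
    · filter_upwards [Lp.coeFn_add x.1.2.1 y.1.2.1, h2, k2] with p e e1 e2
      change (x.1.2.1 + y.1.2.1 : L2 (volume.restrict (annulus a b))) p = _
      rw [e, Pi.add_apply, e1, e2, hd]
      rfl
    · filter_upwards [Lp.coeFn_add x.1.2.2 y.1.2.2, h3, k3] with p e e1 e2
      change (x.1.2.2 + y.1.2.2 : L2 (volume.restrict (annulus a b))) p = _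
      rw [e, Pi.add_apply, e1, e2, hd]
      rfl
    · filter_upwards [Lp.coeFn_add x.2.1 y.2.1, h4, k4] with p e e1 e2
      change (x.2.1 + y.2.1 : L2 (arcMeasure a)) p = _
      rw [e, Pi.add_apply, e1, e2]
    · filter_upwards [Lp.coeFn_add x.2.2 y.2.2, h5, k5] with p e e1 e2
      change (x.2.2 + y.2.2 : L2 (arcMeasure b)) p = _
      rw [e, Pi.add_apply, e1, e2]
  smul_mem' := by
    rintro c x ⟨w, hw, h1, h2, h3, h4, h5⟩
    have hd : ∀ p, fderiv ℝ (fun p => c * w p) p = c • fderiv ℝ w p := fun p =>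
      fderiv_const_mul (hw.differentiable (by simp) p) c
    refine ⟨fun p => c * w p, contDiff_const.mul hw, ?_, ?_, ?_, ?_, ?_⟩
    · filter_upwards [Lp.coeFn_smul c x.1.1, h1] with p e e1
      change (c • x.1.1 : L2 (volume.restrict (annulus a b))) p = _
      rw [e, Pi.smul_apply, e1, smul_eq_mul]
    · filter_upwards [Lp.coeFn_smul c x.1.2.1, h2] with p e e1
      change (c • x.1.2.1 : L2 (volume.restrict (annulus a b))) p = _
      rw [e, Pi.smul_apply, e1, smul_eq_mul, hd]
      rfl
    · filter_upwards [Lp.coeFn_smul c x.1.2.2, h3] with p e e1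
      change (c • x.1.2.2 : L2 (volume.restrict (annulus a b))) p = _
      rw [e, Pi.smul_apply, e1, smul_eq_mul, hd]
      rfl
    · filter_upwards [Lp.coeFn_smul c x.2.1, h4] with p e e1
      change (c • x.2.1 : L2 (arcMeasure a)) p = _
      rw [e, Pi.smul_apply, e1, smul_eq_mul]
    · filter_upwards [Lp.coeFn_smul c x.2.2, h5] with p e e1
      change (c • x.2.2 : L2 (arcMeasure b)) p = _
      rw [e, Pi.smul_apply, e1, smul_eq_mul]

/-- `v ∈ H¹` of the annulus has trace `f` on the inner circle and trace `g` on the outer circle: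
`v` is an `H¹` limit of smooth functions on the closed annulus whose restrictions to the two circles
converge in `L²` to `f` and `g`. (The trace operator is the continuous extension of the restriction
map, and its graph is the closure of the graph of the restriction map.) -/
def HasTrace (a b : ℝ) (v : H1 (annulus a b)) (f : L2 (arcMeasure a)) (g : L2 (arcMeasure b)) :
    Prop :=
  (v.1, f, g) ∈ (smoothGraph a b).topologicalClosure

theorem HasTrace.zero (a b : ℝ) : HasTrace a b 0 0 0 :=
  ((smoothGraph a b).topologicalClosure).zero_mem

theorem HasTrace.add {a b : ℝ} {v v' : H1 (annulus a b)} {f f' : L2 (arcMeasure a)}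
    {g g' : L2 (arcMeasure b)} (h : HasTrace a b v f g) (h' : HasTrace a b v' f' g') :
    HasTrace a b (v + v') (f + f') (g + g') :=
  ((smoothGraph a b).topologicalClosure).add_mem h h'

theorem HasTrace.smul {a b : ℝ} (c : ℝ) {v : H1 (annulus a b)} {f : L2 (arcMeasure a)}
    {g : L2 (arcMeasure b)} (h : HasTrace a b v f g) :
    HasTrace a b (c • v) (c • f) (c • g) :=
  ((smoothGraph a b).topologicalClosure).smul_mem c h

/-- `H^{1/2}` of the inner circle: the traces of `H¹` functions. The norm that this submodule
inherits is the one of `L²` of the inner circle. -/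
def HalfInner (a b : ℝ) : Submodule ℝ (L2 (arcMeasure a)) where
  carrier := {f | ∃ v g, HasTrace a b v f g}
  zero_mem' := ⟨0, 0, HasTrace.zero a b⟩
  add_mem' := by
    rintro f f' ⟨v, g, h⟩ ⟨v', g', h'⟩
    exact ⟨v + v', g + g', h.add h'⟩
  smul_mem' := by
    rintro c f ⟨v, g, h⟩
    exact ⟨c • v, c • g, h.smul c⟩

/-- `H^{1/2}` of the outer circle: the traces of `H¹` functions. -/
def HalfOuter (a b : ℝ) : Submodule ℝ (L2 (arcMeasure b)) where
  carrier := {g | ∃ v f, HasTrace a b v f g}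
  zero_mem' := ⟨0, 0, HasTrace.zero a b⟩
  add_mem' := by
    rintro g g' ⟨v, f, h⟩ ⟨v', f', h'⟩
    exact ⟨v + v', f + f', h.add h'⟩
  smul_mem' := by
    rintro c g ⟨v, f, h⟩
    exact ⟨c • v, c • f, h.smul c⟩

theorem HasTrace.mem_outer {a b : ℝ} {v : H1 (annulus a b)} {f : L2 (arcMeasure a)}
    {g : L2 (arcMeasure b)} (h : HasTrace a b v f g) : g ∈ HalfOuter a b :=
  ⟨v, f, h⟩

/-- The `H^{1/2}` norm on the outer circle: the least `H¹` norm of an extension. -/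
def normHalfOuter {a b : ℝ} (g : HalfOuter a b) : ℝ :=
  sInf {t | ∃ v f, HasTrace a b v f g.1 ∧ t = normH1 v}

/-- The linear functional `q` on `H^{1/2}` of the outer circle is in `H^{-1/2}`, the dual space. -/
def IsNegHalf {a b : ℝ} (q : HalfOuter a b →ₗ[ℝ] ℝ) : Prop :=
  ∃ C : ℝ, ∀ g, |q g| ≤ C * normHalfOuter g

/-- `v ∈ H¹` is the weak solution of the primary problem `-Δv = 0` in the annulus, `∂v/∂n = q` on
the outer circle (in `H^{-1/2}`), `v = ω` on the inner circle; and `g` is the trace of `v` on the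
outer circle. -/
def IsPrimarySolution {a b : ℝ} (q : HalfOuter a b →ₗ[ℝ] ℝ) (ω : L2 (arcMeasure a))
    (v : H1 (annulus a b)) (g : L2 (arcMeasure b)) : Prop :=
  HasTrace a b v ω g ∧
    ∀ (φ : H1 (annulus a b)) (γ : L2 (arcMeasure b)) (h : HasTrace a b φ 0 γ),
      dirichletForm v φ = q ⟨γ, h.mem_outer⟩

/-- `(u, q)` are Cauchy data of a harmonic function: some weakly harmonic `v ∈ H¹` has trace `u`
and normal derivative `q` on the outer circle. -/
def IsCauchyData {a b : ℝ} (u : HalfOuter a b) (q : HalfOuter a b →ₗ[ℝ] ℝ) : Prop :=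
  IsNegHalf q ∧ ∃ (ω : HalfInner a b) (v : H1 (annulus a b)), IsPrimarySolution q ω.1 v u.1

/-- The functional `J(ω) = ∫ |v(ω) - u|² dΓ` over the outer circle, `v(ω)` the solution of the
primary problem. (The infimum is over the solutions, of which there is exactly one.) -/
def costJ {a b : ℝ} (u : HalfOuter a b) (q : HalfOuter a b →ₗ[ℝ] ℝ) (ω : HalfInner a b) : ℝ≥0∞ :=
  ⨅ (v : H1 (annulus a b)) (g : L2 (arcMeasure b)) (_ : IsPrimarySolution q ω.1 v g),
    ENNReal.ofReal (∫ p, |(g - u.1 : L2 (arcMeasure b)) p| ^ 2 ∂(arcMeasure b))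

/-- `G` is the first variation `J'(ω)`: `J(ω + δ) - J(ω) = (G, δ) + o(‖δ‖)` for `δ` in `H^{1/2}` of
the inner circle, with the inner product and the norm of `L²` of the inner circle. -/
def IsFirstVariation {a b : ℝ} (u : HalfOuter a b) (q : HalfOuter a b →ₗ[ℝ] ℝ)
    (ω : HalfInner a b) (G : L2 (arcMeasure a)) : Prop :=
  (fun δ : HalfInner a b =>
      (costJ u q (ω + δ)).toReal - (costJ u q ω).toReal - inner ℝ G (δ : L2 (arcMeasure a)))
    =o[𝓝 0] fun δ : HalfInner a b => ‖(δ : L2 (arcMeasure a))‖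

/-- `v ∈ H¹` is the weak solution of `-Δv = 0` in the annulus, `∂v/∂n = d` on the outer circle,
`v = 0` on the inner circle. -/
def IsAdjointSolution {a b : ℝ} (d : L2 (arcMeasure b)) (v : H1 (annulus a b)) : Prop :=
  (∃ g, HasTrace a b v 0 g) ∧
    ∀ (φ : H1 (annulus a b)) (γ : L2 (arcMeasure b)), HasTrace a b φ 0 γ →
      dirichletForm v φ = inner ℝ d γ

/-- For `v` harmonic in the annulus with `∂v/∂n = d` on the outer circle, `κ` is the normal
derivative `∂v/∂n` on the inner circle (`n` is the unit normal that points out of the annulus),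
in the sense of Green's formula. -/
def HasInnerNormalDeriv {a b : ℝ} (v : H1 (annulus a b)) (d : L2 (arcMeasure b))
    (κ : L2 (arcMeasure a)) : Prop :=
  ∀ (φ : H1 (annulus a b)) (f : L2 (arcMeasure a)) (g : L2 (arcMeasure b)), HasTrace a b φ f g →
    dirichletForm v φ = inner ℝ d g + inner ℝ κ f

/-- `G` is the output of one pass of the adjoint method at `ω`: solve the primary problem for `v`,
then the adjoint problem with `∂v'/∂n = 2 (v - u)` on the outer circle for `v'`, and put
`G = -∂v'/∂n` on the inner circle. -/
def IsAdjointGradient {a b : ℝ} (u : HalfOuter a b) (q : HalfOuter a b →ₗ[ℝ] ℝ)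
    (ω : HalfInner a b) (G : L2 (arcMeasure a)) : Prop :=
  ∃ (v : H1 (annulus a b)) (g : L2 (arcMeasure b)) (v' : H1 (annulus a b)),
    IsPrimarySolution q ω.1 v g ∧
    IsAdjointSolution ((2 : ℝ) • (g - u.1)) v' ∧
    HasInnerNormalDeriv v' ((2 : ℝ) • (g - u.1)) (-G)

/-- `C_j = 8 b^(2|j|+1) a^(2|j|-1) / (a^(2|j|) + b^(2|j|))²`. -/
def coeffC (a b : ℝ) (j : ℤ) : ℝ :=
  8 * b ^ (2 * |j| + 1) * a ^ (2 * |j| - 1) / (a ^ (2 * |j|) + b ^ (2 * |j|)) ^ 2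

/-- `f = ∑_{M ≤ |j| ≤ N} c_j e^{ijθ}` on the circle of radius `R`, with complex coefficients. -/
def HasFiniteFourier (R : ℝ) (M N : ℕ) (f : L2 (arcMeasure R)) : Prop :=
  ∃ c : ℤ → ℂ, ∀ᵐ θ ∂(volume.restrict (Set.Ioc (-Real.pi) Real.pi)),
    ((f (circlePoint R θ) : ℝ) : ℂ) =
      ∑ j ∈ (Finset.Icc (-(N : ℤ)) N).filter (fun j => (M : ℤ) ≤ |j|),
        c j * Complex.exp (Complex.I * j * θ)

end

end AnnulusCauchy

open AnnulusCauchy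

namespace AnnulusCauchy

/-! Let `T` send inner Dirichlet data to the outer trace of the harmonic function with those data
and zero flux through the outer circle. Cauchy data make the minimum of `J` equal to `0`, so `v(ω*)`
has outer trace `u`. For `μ = ω* - ω` this gives `v(ω) - u = -T μ` on the outer circle and `J' = -2
T* T μ`.

The operator `T` is diagonal in the Fourier modes: `(r^n + (b²/r)^n) Re (c e^{inθ})` is harmonic
with zero radial derivative at `r = b`, so `T` multiplies the mode `n` by `τ_n = 2 b^n / (a^n +
(b²/a)^n)`. Arc length is `b dθ` outside and `a dθ` inside, so `2 T* T` multiplies it by `2 (b/a)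
τ_n² = C_n`. A descent step therefore multiplies the `j`-th term of the error by `1 - ρ_k C_j`. Both
choices of step sizes use every `C_m` with `M ≤ m ≤ N` once, so each term is annihilated at some
step.

No general existence theorem is needed. The modes are explicit solutions
(`exists_isPrimarySolution_mode`, by Green's formula for smooth test functions and density), and
`v(ω_k)` is `v(ω*)` minus a finite sum of them. `trace_inequality` makes the outer trace of a
solution unique. Both meanings of `J'` give `(J', δ) = 2 (v(ω) - u, T δ)` for the modes `δ` (the two
lemmas `inner_eq`), and completeness of the modes (`eq_zero_of_inner_circleMode`) then determines
`J'`; this is `gradient_eq`. -/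

/-! ### Measures on the circles and on the annulus -/

theorem continuous_circlePoint_uncurry : Continuous fun x : ℝ × ℝ => circlePoint x.1 x.2 := by
  unfold circlePoint; fun_prop

theorem continuous_circlePoint (R : ℝ) : Continuous (circlePoint R) := by
  unfold circlePoint; fun_prop

instance isFiniteMeasure_arcMeasure (R : ℝ) : IsFiniteMeasure (arcMeasure R) := by
  unfold arcMeasure
  have : IsFiniteMeasure
      (ENNReal.ofReal R • volume.restrict (Set.Ioc (-Real.pi) Real.pi) : Measure ℝ) :=
    Measure.smul_finite _ ENNReal.ofReal_ne_top
  infer_instance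

theorem ae_arcMeasure_iff {R : ℝ} (hR : 0 < R) {P : Plane → Prop} (hP : MeasurableSet {p | P p}) :
    (∀ᵐ p ∂arcMeasure R, P p) ↔
      ∀ᵐ θ ∂(volume.restrict (Set.Ioc (-Real.pi) Real.pi)), P (circlePoint R θ) := by
  rw [arcMeasure, ae_map_iff (continuous_circlePoint R).measurable.aemeasurable hP]
  exact Measure.ae_ennreal_smul_measure_iff (by simpa using hR)

theorem ae_eq_arcMeasure_of_circlePoint {R : ℝ} (hR : 0 < R) (f : L2 (arcMeasure R))
    {w : Plane → ℝ} (hw : Continuous w)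
    (h : ∀ᵐ θ ∂(volume.restrict (Set.Ioc (-Real.pi) Real.pi)),
      f (circlePoint R θ) = w (circlePoint R θ)) : f =ᵐ[arcMeasure R] w := by
  refine (ae_arcMeasure_iff hR ?_).2 h
  exact measurableSet_eq_fun (Lp.stronglyMeasurable f).measurable hw.measurable

theorem ae_eq_of_eq_circlePoint {R : ℝ} (hR : 0 < R) {w w' : Plane → ℝ} (hw : Continuous w)
    (hw' : Continuous w') (h : ∀ θ, w (circlePoint R θ) = w' (circlePoint R θ)) :
    w =ᵐ[arcMeasure R] w' := by
  refine (ae_arcMeasure_iff hR ?_).2 (Eventually.of_forall h)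
  exact measurableSet_eq_fun hw.measurable hw'.measurable

theorem integral_arcMeasure {R : ℝ} (hR : 0 < R) {w : Plane → ℝ}
    (hw : AEStronglyMeasurable w (arcMeasure R)) :
    ∫ p, w p ∂arcMeasure R = R * ∫ θ in (-Real.pi)..Real.pi, w (circlePoint R θ) := by
  rw [arcMeasure, integral_map (continuous_circlePoint R).measurable.aemeasurable hw,
    integral_smul_measure, ENNReal.toReal_ofReal hR.le,
    intervalIntegral.integral_of_le (by linarith [Real.pi_pos]), smul_eq_mul]

theorem memLp_of_ae_mem_compact {m : Measure Plane} [IsFiniteMeasure m] {K : Set Plane}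
    (hK : IsCompact K) (hm : ∀ᵐ p ∂m, p ∈ K) {w : Plane → ℝ} (hw : Continuous w) :
    MemLp w 2 m := by
  obtain ⟨C, hC⟩ := hK.exists_bound_of_continuousOn hw.continuousOn
  exact MemLp.of_bound hw.aestronglyMeasurable C (hm.mono hC)

theorem memLp_arcMeasure (R : ℝ) {w : Plane → ℝ} (hw : Continuous w) :
    MemLp w 2 (arcMeasure R) := by
  have hK : IsCompact (circlePoint R '' Set.Icc (-Real.pi) Real.pi) :=
    isCompact_Icc.image (continuous_circlePoint R)
  refine memLp_of_ae_mem_compact hK ?_ hw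
  rw [arcMeasure]
  refine (ae_map_iff (continuous_circlePoint R).measurable.aemeasurable
    hK.isClosed.measurableSet).2 ?_
  refine Measure.ae_smul_measure ?_ _
  filter_upwards [ae_restrict_mem measurableSet_Ioc] with θ hθ
  exact ⟨θ, Set.Ioc_subset_Icc_self hθ, rfl⟩

theorem isOpen_annulus (a b : ℝ) : IsOpen (annulus a b) := by
  have h : Continuous fun p : Plane => p.1 ^ 2 + p.2 ^ 2 := by fun_prop
  exact (isOpen_lt continuous_const h).inter (isOpen_lt h continuous_const)

theorem annulus_subset (a b : ℝ) : annulus a b ⊆ Set.Icc (-|b|) |b| ×ˢ Set.Icc (-|b|) |b| := by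
  rintro ⟨x, y⟩ ⟨-, h⟩
  simp only at h
  refine ⟨abs_le.1 (sq_le_sq.1 ?_), abs_le.1 (sq_le_sq.1 ?_)⟩ <;>
    nlinarith [sq_nonneg x, sq_nonneg y]

instance isFiniteMeasure_annulus (a b : ℝ) : IsFiniteMeasure (volume.restrict (annulus a b)) := by
  refine ⟨?_⟩
  rw [Measure.restrict_apply_univ]
  exact (measure_mono (annulus_subset a b)).trans_lt
    (isCompact_Icc.prod isCompact_Icc).measure_lt_top

theorem memLp_annulus (a b : ℝ) {w : Plane → ℝ} (hw : Continuous w) :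
    MemLp w 2 (volume.restrict (annulus a b)) := by
  refine memLp_of_ae_mem_compact
    ((isCompact_Icc (a := -|b|) (b := |b|)).prod (isCompact_Icc (a := -|b|) (b := |b|))) ?_ hw
  filter_upwards [ae_restrict_mem (isOpen_annulus a b).measurableSet] with p hp
  exact annulus_subset a b hp

/-! ### Polar coordinates -/

theorem integral_annulus {a b : ℝ} (ha : 0 < a) (hab : a < b) (f : Plane → ℝ) :
    ∫ p in annulus a b, f p =
      ∫ x in Set.Ioo a b ×ˢ Set.Ioo (-Real.pi) Real.pi, x.1 * f (circlePoint x.1 x.2) := by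
  have hm := (isOpen_annulus a b).measurableSet
  rw [← integral_indicator hm, ← integral_comp_polarCoord_symm]
  have hs : MeasurableSet (Set.Ioo a b ×ˢ Set.Ioo (-Real.pi) Real.pi) :=
    measurableSet_Ioo.prod measurableSet_Ioo
  have hsub : Set.Ioo a b ×ˢ Set.Ioo (-Real.pi) Real.pi ⊆ polarCoord.target := by
    rintro ⟨r, θ⟩ ⟨hr, hθ⟩
    exact ⟨ha.trans hr.1, hθ⟩
  -- With both sides written as integrals of indicators, the claim is pointwise: in the polar chart
  -- a point lies in the annulus exactly when `a < r < b`.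
  rw [← integral_indicator hs, ← integral_indicator polarCoord.open_target.measurableSet]
  refine integral_congr_ae (Eventually.of_forall ?_)
  rintro ⟨r, θ⟩
  have hp : polarCoord.symm (r, θ) = circlePoint r θ := rfl
  have hcp : (circlePoint r θ).1 ^ 2 + (circlePoint r θ).2 ^ 2 = r ^ 2 := by
    simp only [circlePoint]
    linear_combination r ^ 2 * Real.sin_sq_add_cos_sq θ
  by_cases h1 : (r, θ) ∈ polarCoord.target
  · have hr : 0 < r := h1.1
    have hiff : circlePoint r θ ∈ annulus a b ↔ (r, θ) ∈ Set.Ioo a b ×ˢ Set.Ioo (-Real.pi) Real.pi := by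
      simp only [annulus, Set.mem_ofPred_eq, hcp]
      rw [pow_lt_pow_iff_left₀ ha.le hr.le two_ne_zero,
        pow_lt_pow_iff_left₀ hr.le (ha.trans hab).le two_ne_zero]
      exact ⟨fun h => ⟨h, h1.2⟩, fun h => h.1⟩
    by_cases h2 : (r, θ) ∈ Set.Ioo a b ×ˢ Set.Ioo (-Real.pi) Real.pi
    · simp only [Set.indicator_of_mem h1, Set.indicator_of_mem h2, hp,
        Set.indicator_of_mem (hiff.2 h2), smul_eq_mul]
    · simp only [Set.indicator_of_mem h1, Set.indicator_of_notMem h2, hp,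
        Set.indicator_of_notMem (fun h => h2 (hiff.1 h)), smul_zero]
  · simp only [Set.indicator_of_notMem h1, Set.indicator_of_notMem (fun h => h1 (hsub h))]

/-- Continuity is asked only for `a ≤ r ≤ b`, because later integrands contain `1 / r`; the closed
radial interval gives compactness. -/
theorem integrableOn_polar {a b : ℝ} {F : ℝ × ℝ → ℝ}
    (hF : ContinuousOn F (Set.Icc a b ×ˢ Set.univ)) :
    IntegrableOn F (Set.Ioo a b ×ˢ Set.Ioo (-Real.pi) Real.pi) := by
  have h : IntegrableOn F (Set.Icc a b ×ˢ Set.Icc (-Real.pi) Real.pi) :=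
    (hF.mono (Set.prod_mono subset_rfl (Set.subset_univ _))).integrableOn_compact
      (isCompact_Icc.prod isCompact_Icc)
  exact h.mono_set (Set.prod_mono Set.Ioo_subset_Icc_self Set.Ioo_subset_Icc_self)

theorem setIntegral_polar {a b : ℝ} (hab : a < b) {F : ℝ × ℝ → ℝ}
    (hF : ContinuousOn F (Set.Icc a b ×ˢ Set.univ)) :
    ∫ x in Set.Ioo a b ×ˢ Set.Ioo (-Real.pi) Real.pi, F x =
      ∫ r in a..b, ∫ θ in (-Real.pi)..Real.pi, F (r, θ) := by
  have h := integrableOn_polar hF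
  rw [Measure.volume_eq_prod] at h ⊢
  rw [setIntegral_prod _ h, intervalIntegral.integral_of_le hab.le, integral_Ioc_eq_integral_Ioo]
  refine integral_congr_ae (Eventually.of_forall fun r => ?_)
  simp only
  rw [intervalIntegral.integral_of_le (by linarith [Real.pi_pos]), integral_Ioc_eq_integral_Ioo]

/-- Both orders of integration are needed: Green's formula integrates one term exactly in `r` and
the other in `θ`. -/
theorem setIntegral_polar' {a b : ℝ} (hab : a < b) {F : ℝ × ℝ → ℝ}
    (hF : ContinuousOn F (Set.Icc a b ×ˢ Set.univ)) :
    ∫ x in Set.Ioo a b ×ˢ Set.Ioo (-Real.pi) Real.pi, F x =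
      ∫ θ in (-Real.pi)..Real.pi, ∫ r in a..b, F (r, θ) := by
  have h := integrableOn_polar hF
  rw [Measure.volume_eq_prod] at h ⊢
  have h' : IntegrableOn (fun z : ℝ × ℝ => F z.swap)
      (Set.Ioo (-Real.pi) Real.pi ×ˢ Set.Ioo a b) (volume.prod volume) := h.swap
  rw [← setIntegral_prod_swap, setIntegral_prod _ h',
    intervalIntegral.integral_of_le (by linarith [Real.pi_pos]), integral_Ioc_eq_integral_Ioo]
  refine integral_congr_ae (Eventually.of_forall fun r => ?_)
  simp only
  rw [intervalIntegral.integral_of_le hab.le, integral_Ioc_eq_integral_Ioo]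
  rfl

/-! ### Smooth functions as elements of `H¹`, and their polar derivatives -/

theorem continuous_fderiv_apply_const {w : Plane → ℝ} (hw : ContDiff ℝ (⊤ : ℕ∞) w) (e : Plane) :
    Continuous fun p => fderiv ℝ w p e :=
  (hw.continuous_fderiv (by simp)).clm_apply continuous_const

theorem isWeakDeriv_smooth {Ω : Set Plane} {w : Plane → ℝ} (hw : ContDiff ℝ (⊤ : ℕ∞) w) (e : Plane)
    {f g : L2 (volume.restrict Ω)} (hf : f =ᵐ[volume.restrict Ω] w)
    (hg : g =ᵐ[volume.restrict Ω] fun p => fderiv ℝ w p e) : IsWeakDeriv Ω e f g := by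
  intro φ hφ hc hs
  have e1 : ∫ p in Ω, f p * fderiv ℝ φ p e = ∫ p in Ω, w p * fderiv ℝ φ p e :=
    integral_congr_ae (hf.mono fun p hp => by simp only [hp])
  have e2 : ∫ p in Ω, g p * φ p = ∫ p in Ω, fderiv ℝ w p e * φ p :=
    integral_congr_ae (hg.mono fun p hp => by simp only [hp])
  have hφ0 : ∀ p, p ∉ Ω → φ p = 0 := fun p hp => image_eq_zero_of_notMem_tsupport fun h => hp (hs h)
  have hφ1 : ∀ p, p ∉ Ω → fderiv ℝ φ p e = 0 := fun p hp => by
    rw [fderiv_of_notMem_tsupport ℝ fun h => hp (hs h)]; rfl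
  -- The test function and its derivative vanish off `Ω`, so the integration by parts takes place on
  -- the whole plane and the boundary of `Ω` plays no role.
  rw [e1, e2, setIntegral_eq_integral_of_forall_compl_eq_zero fun p hp => by rw [hφ1 p hp, mul_zero],
    setIntegral_eq_integral_of_forall_compl_eq_zero fun p hp => by rw [hφ0 p hp, mul_zero]]
  have c1 := continuous_fderiv_apply_const hφ e
  have c2 := continuous_fderiv_apply_const hw e
  exact integral_mul_fderiv_eq_neg_fderiv_mul_of_integrable
    ((c2.mul hφ.continuous).integrable_of_hasCompactSupport hc.mul_left)
    ((hw.continuous.mul c1).integrable_of_hasCompactSupport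
      ((hc.fderiv_apply (𝕜 := ℝ) e).mul_left))
    ((hw.continuous.mul hφ.continuous).integrable_of_hasCompactSupport hc.mul_left)
    (fun p _ => hw.differentiable (by simp) p) (fun p _ => hφ.differentiable (by simp) p)

/-- A smooth function on the plane gives an `H¹` function on the annulus, with its classical
derivatives and with the restrictions to the two circles as traces. -/
theorem exists_smooth_hasTrace (a b : ℝ) {w : Plane → ℝ} (hw : ContDiff ℝ (⊤ : ℕ∞) w)
    {f : L2 (arcMeasure a)} {g : L2 (arcMeasure b)} (hf : f =ᵐ[arcMeasure a] w)
    (hg : g =ᵐ[arcMeasure b] w) :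
    ∃ v : H1 (annulus a b), HasTrace a b v f g ∧
      v.1.2.1 =ᵐ[volume.restrict (annulus a b)] (fun p => fderiv ℝ w p (1, 0)) ∧
      v.1.2.2 =ᵐ[volume.restrict (annulus a b)] (fun p => fderiv ℝ w p (0, 1)) := by
  have m0 := memLp_annulus a b hw.continuous
  have m1 := memLp_annulus a b (continuous_fderiv_apply_const hw (1, 0))
  have m2 := memLp_annulus a b (continuous_fderiv_apply_const hw (0, 1))
  refine ⟨⟨(m0.toLp _, m1.toLp _, m2.toLp _),
    isWeakDeriv_smooth hw _ m0.coeFn_toLp m1.coeFn_toLp,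
    isWeakDeriv_smooth hw _ m0.coeFn_toLp m2.coeFn_toLp⟩, ?_, m1.coeFn_toLp, m2.coeFn_toLp⟩
  exact Submodule.le_topologicalClosure _
    ⟨w, hw, m0.coeFn_toLp, m1.coeFn_toLp, m2.coeFn_toLp, hf, hg⟩

theorem inner_eq_integral {m : Measure Plane} {f g : L2 m} {w z : Plane → ℝ}
    (hf : f =ᵐ[m] w) (hg : g =ᵐ[m] z) : inner ℝ f g = ∫ p, w p * z p ∂m := by
  rw [L2.inner_def]
  refine integral_congr_ae ?_
  filter_upwards [hf, hg] with p h1 h2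
  simp [h1, h2, mul_comm]

theorem fderiv_apply_prod (φ : Plane → ℝ) (p : Plane) (x y : ℝ) :
    fderiv ℝ φ p (x, y) = x * fderiv ℝ φ p (1, 0) + y * fderiv ℝ φ p (0, 1) := by
  have h : ((x, y) : Plane) = x • ((1, 0) : Plane) + y • ((0, 1) : Plane) := by simp
  rw [h, map_add, map_smul, map_smul, smul_eq_mul, smul_eq_mul]

theorem hasDerivAt_radial {φ : Plane → ℝ} (hφ : ContDiff ℝ (⊤ : ℕ∞) φ) (r θ : ℝ) :
    HasDerivAt (fun r => φ (circlePoint r θ))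
      (fderiv ℝ φ (circlePoint r θ) (Real.cos θ, Real.sin θ)) r := by
  have h1 : HasDerivAt (fun r => circlePoint r θ) (Real.cos θ, Real.sin θ) r := by
    simpa [circlePoint] using!
      ((hasDerivAt_id r).mul_const (Real.cos θ)).prodMk ((hasDerivAt_id r).mul_const (Real.sin θ))
  exact (hφ.differentiable (by simp) _).hasFDerivAt.comp_hasDerivAt r h1

theorem hasDerivAt_angular {φ : Plane → ℝ} (hφ : ContDiff ℝ (⊤ : ℕ∞) φ) (r θ : ℝ) :
    HasDerivAt (fun θ => φ (circlePoint r θ))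
      (fderiv ℝ φ (circlePoint r θ) (-(r * Real.sin θ), r * Real.cos θ)) θ := by
  have h1 : HasDerivAt (fun θ => circlePoint r θ) (-(r * Real.sin θ), r * Real.cos θ) θ := by
    simpa [circlePoint] using!
      ((Real.hasDerivAt_cos θ).const_mul r).prodMk ((Real.hasDerivAt_sin θ).const_mul r)
  exact (hφ.differentiable (by simp) _).hasFDerivAt.comp_hasDerivAt θ h1

theorem continuous_fderiv_circlePoint {φ : Plane → ℝ} (hφ : ContDiff ℝ (⊤ : ℕ∞) φ) (e : Plane) :
    Continuous fun x : ℝ × ℝ => fderiv ℝ φ (circlePoint x.1 x.2) e :=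
  (continuous_fderiv_apply_const hφ e).comp continuous_circlePoint_uncurry

theorem continuous_radial {φ : Plane → ℝ} (hφ : ContDiff ℝ (⊤ : ℕ∞) φ) :
    Continuous fun x : ℝ × ℝ =>
      fderiv ℝ φ (circlePoint x.1 x.2) (Real.cos x.2, Real.sin x.2) := by
  have h1 := continuous_fderiv_circlePoint hφ (1, 0)
  have h2 := continuous_fderiv_circlePoint hφ (0, 1)
  simp_rw [fderiv_apply_prod φ _ (Real.cos _)]
  fun_prop

theorem continuous_angular {φ : Plane → ℝ} (hφ : ContDiff ℝ (⊤ : ℕ∞) φ) :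
    Continuous fun x : ℝ × ℝ =>
      fderiv ℝ φ (circlePoint x.1 x.2) (-(x.1 * Real.sin x.2), x.1 * Real.cos x.2) := by
  have h1 := continuous_fderiv_circlePoint hφ (1, 0)
  have h2 := continuous_fderiv_circlePoint hφ (0, 1)
  simp_rw [fderiv_apply_prod φ _ (-(_ * Real.sin _))]
  fun_prop

/-! ### The trace inequality -/

/-- Cauchy–Schwarz against the constant `1`, obtained from nonnegativity of the integral of `(f -
m)²` with `m` the mean of `f`. -/
theorem sq_intervalIntegral_le {a b : ℝ} (hab : a < b) {f : ℝ → ℝ} (hf : Continuous f) :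
    (∫ r in a..b, f r) ^ 2 ≤ (b - a) * ∫ r in a..b, f r ^ 2 := by
  set S := ∫ r in a..b, f r
  have hpos : 0 < b - a := sub_pos.2 hab
  set m := S / (b - a)
  have h0 : 0 ≤ ∫ r in a..b, (f r - m) ^ 2 :=
    intervalIntegral.integral_nonneg hab.le fun r _ => sq_nonneg _
  have h1 : ∫ r in a..b, (f r - m) ^ 2 = (∫ r in a..b, f r ^ 2) - 2 * m * S + m ^ 2 * (b - a) := by
    have e : ∀ r, (f r - m) ^ 2 = f r ^ 2 - 2 * m * f r + m ^ 2 := fun r => by ring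
    simp_rw [e]
    rw [intervalIntegral.integral_add ((by fun_prop : Continuous _).intervalIntegrable _ _)
      ((by fun_prop : Continuous _).intervalIntegrable _ _),
      intervalIntegral.integral_sub ((by fun_prop : Continuous _).intervalIntegrable _ _)
      ((by fun_prop : Continuous _).intervalIntegrable _ _),
      intervalIntegral.integral_const_mul, intervalIntegral.integral_const, smul_eq_mul]
    ring
  have hS : S = m * (b - a) := (div_mul_cancel₀ S hpos.ne').symm
  rw [h1, hS] at h0
  rw [hS]
  nlinarith

/-- On each ray the increment of `w` from `a` to `b` is the integral of its radial derivative, which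
Cauchy–Schwarz bounds. The weight `a ≤ r` turns `dr` into the area element `r dr`, and the factors
`2` come from splitting the square of a sum. -/
theorem trace_inequality_smooth {a b : ℝ} (ha : 0 < a) (hab : a < b) {w : Plane → ℝ}
    (hw : ContDiff ℝ (⊤ : ℕ∞) w) :
    a * ∫ θ in (-Real.pi)..Real.pi, w (circlePoint b θ) ^ 2 ≤
      2 * a * (∫ θ in (-Real.pi)..Real.pi, w (circlePoint a θ) ^ 2) +
      2 * (b - a) *
        ∫ p in annulus a b, (fderiv ℝ w p (1, 0) ^ 2 + fderiv ℝ w p (0, 1) ^ 2) := by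
  have hwc := hw.continuous
  have c1 := continuous_fderiv_circlePoint hw (1, 0)
  have c2 := continuous_fderiv_circlePoint hw (0, 1)
  have hca := continuous_circlePoint a
  have hcb := continuous_circlePoint b
  have hF : Continuous fun x : ℝ × ℝ => x.1 *
      (fderiv ℝ w (circlePoint x.1 x.2) (1, 0) ^ 2 +
        fderiv ℝ w (circlePoint x.1 x.2) (0, 1) ^ 2) := by fun_prop
  rw [integral_annulus ha hab, setIntegral_polar' hab hF.continuousOn]
  simp only
  have hI : Continuous fun θ : ℝ => ∫ r in a..b, r *
      (fderiv ℝ w (circlePoint r θ) (1, 0) ^ 2 + fderiv ℝ w (circlePoint r θ) (0, 1) ^ 2) :=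
    intervalIntegral.continuous_parametric_intervalIntegral_of_continuous'
      (f := fun θ r => r * (fderiv ℝ w (circlePoint r θ) (1, 0) ^ 2 +
        fderiv ℝ w (circlePoint r θ) (0, 1) ^ 2))
      (hF.comp continuous_swap) a b
  have hpt : ∀ θ : ℝ, a * w (circlePoint b θ) ^ 2 ≤ 2 * a * w (circlePoint a θ) ^ 2 +
      2 * (b - a) * ∫ r in a..b, r *
      (fderiv ℝ w (circlePoint r θ) (1, 0) ^ 2 + fderiv ℝ w (circlePoint r θ) (0, 1) ^ 2) := by
    intro θ
    have hc : Continuous fun r => fderiv ℝ w (circlePoint r θ) (Real.cos θ, Real.sin θ) :=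
      (continuous_radial hw).comp (continuous_id.prodMk continuous_const)
    have ftc := intervalIntegral.integral_eq_sub_of_hasDerivAt (a := a) (b := b)
      (fun r _ => hasDerivAt_radial hw r θ) (hc.intervalIntegrable _ _)
    have cs := sq_intervalIntegral_le hab hc
    rw [ftc] at cs
    have hle : a * ∫ r in a..b, fderiv ℝ w (circlePoint r θ) (Real.cos θ, Real.sin θ) ^ 2 ≤
        ∫ r in a..b, r *
        (fderiv ℝ w (circlePoint r θ) (1, 0) ^ 2 + fderiv ℝ w (circlePoint r θ) (0, 1) ^ 2) := by
      rw [← intervalIntegral.integral_const_mul]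
      refine intervalIntegral.integral_mono_on hab.le
        ((by fun_prop : Continuous _).intervalIntegrable _ _)
        ((hF.comp (continuous_id.prodMk continuous_const)).intervalIntegrable _ _) fun r hr => ?_
      rw [fderiv_apply_prod]
      set X := fderiv ℝ w (circlePoint r θ) (1, 0)
      set Y := fderiv ℝ w (circlePoint r θ) (0, 1)
      have hXY : (Real.cos θ * X + Real.sin θ * Y) ^ 2 ≤ X ^ 2 + Y ^ 2 := by
        have := Real.sin_sq_add_cos_sq θ
        have h2 : X ^ 2 + Y ^ 2 - (Real.cos θ * X + Real.sin θ * Y) ^ 2 =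
            (Real.sin θ * X - Real.cos θ * Y) ^ 2 := by
          linear_combination (-(X ^ 2 + Y ^ 2)) * this
        nlinarith [sq_nonneg (Real.sin θ * X - Real.cos θ * Y)]
      exact mul_le_mul hr.1 hXY (sq_nonneg _) (ha.le.trans hr.1)
    have h3 : w (circlePoint b θ) ^ 2 ≤ 2 * w (circlePoint a θ) ^ 2 +
        2 * (w (circlePoint b θ) - w (circlePoint a θ)) ^ 2 := by
      nlinarith [sq_nonneg (w (circlePoint b θ) - 2 * w (circlePoint a θ))]
    have h4 := mul_le_mul_of_nonneg_left cs ha.le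
    have h5 := mul_le_mul_of_nonneg_left hle (sub_pos.2 hab).le
    have h6 := mul_le_mul_of_nonneg_left h3 ha.le
    linarith
  rw [← intervalIntegral.integral_const_mul, ← intervalIntegral.integral_const_mul,
    ← intervalIntegral.integral_const_mul,
    ← intervalIntegral.integral_add ((by fun_prop : Continuous _).intervalIntegrable _ _)
      ((by fun_prop : Continuous _).intervalIntegrable _ _)]
  exact intervalIntegral.integral_mono (by linarith [Real.pi_pos])
    ((by fun_prop : Continuous _).intervalIntegrable _ _)
    ((by fun_prop : Continuous _).intervalIntegrable _ _) hpt

theorem inner_add_inner_eq_integral {m : Measure Plane} {f₁ g₁ f₂ g₂ : L2 m}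
    {w₁ z₁ w₂ z₂ : Plane → ℝ} (hf₁ : f₁ =ᵐ[m] w₁) (hg₁ : g₁ =ᵐ[m] z₁) (hf₂ : f₂ =ᵐ[m] w₂)
    (hg₂ : g₂ =ᵐ[m] z₂) :
    inner ℝ f₁ g₁ + inner ℝ f₂ g₂ = ∫ p, (w₁ p * z₁ p + w₂ p * z₂ p) ∂m := by
  rw [inner_eq_integral hf₁ hg₁, inner_eq_integral hf₂ hg₂]
  exact (integral_add (((memLp_congr_ae hf₁).1 (Lp.memLp f₁)).integrable_mul
    ((memLp_congr_ae hg₁).1 (Lp.memLp g₁))) (((memLp_congr_ae hf₂).1 (Lp.memLp f₂)).integrable_mul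
    ((memLp_congr_ae hg₂).1 (Lp.memLp g₂)))).symm

theorem trace_inequality_smoothGraph {a b : ℝ} (ha : 0 < a) (hab : a < b)
    {x : Jet (annulus a b) × L2 (arcMeasure a) × L2 (arcMeasure b)} (hx : x ∈ smoothGraph a b) :
    a * ‖x.2.2‖ ^ 2 ≤ b * (2 * ‖x.2.1‖ ^ 2 +
      2 * (b - a) * (inner ℝ x.1.2.1 x.1.2.1 + inner ℝ x.1.2.2 x.1.2.2)) := by
  obtain ⟨w, hw, -, h1, h2, h3, h4⟩ := hx
  have hb := ha.trans hab
  have hwc := hw.continuous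
  have hm : Continuous fun p => w p * w p := hwc.mul hwc
  rw [inner_add_inner_eq_integral h1 h1 h2 h2, ← real_inner_self_eq_norm_sq,
    ← real_inner_self_eq_norm_sq, inner_eq_integral h3 h3, inner_eq_integral h4 h4,
    integral_arcMeasure ha hm.aestronglyMeasurable, integral_arcMeasure hb hm.aestronglyMeasurable]
  -- The factor `b` converts the outer integral in `dθ` to arc length; the inner one already carries
  -- its factor `a`.
  have := mul_le_mul_of_nonneg_left (trace_inequality_smooth ha hab hw) hb.le
  simp only [pow_two] at this ⊢
  linarith


/-- A non-strict inequality between continuous functions passes from smooth functions to `H¹`. -/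
theorem HasTrace.le_of_smooth {a b : ℝ}
    {F K : Jet (annulus a b) × L2 (arcMeasure a) × L2 (arcMeasure b) → ℝ} (hF : Continuous F)
    (hK : Continuous K) (hFK : ∀ x ∈ smoothGraph a b, F x ≤ K x) {v : H1 (annulus a b)}
    {f : L2 (arcMeasure a)} {g : L2 (arcMeasure b)} (h : HasTrace a b v f g) :
    F (v.1, f, g) ≤ K (v.1, f, g) := by
  have key : ∀ x ∈ (smoothGraph a b).topologicalClosure, F x ≤ K x := fun x hx =>
    closure_minimal hFK (isClosed_le hF hK) hx
  exact key _ h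

/-- The outer trace is controlled by the inner trace and the Dirichlet integral. -/
theorem trace_inequality {a b : ℝ} (ha : 0 < a) (hab : a < b) {v : H1 (annulus a b)}
    {f : L2 (arcMeasure a)} {g : L2 (arcMeasure b)} (h : HasTrace a b v f g) :
    a * ‖g‖ ^ 2 ≤ b * (2 * ‖f‖ ^ 2 + 2 * (b - a) * dirichletForm v v) :=
  h.le_of_smooth (F := fun x => a * ‖x.2.2‖ ^ 2) (K := fun x => b * (2 * ‖x.2.1‖ ^ 2 +
    2 * (b - a) * (inner ℝ x.1.2.1 x.1.2.1 + inner ℝ x.1.2.2 x.1.2.2)))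
    (by fun_prop) (by fun_prop) fun _ hx => trace_inequality_smoothGraph ha hab hx

/-! ### Green's formula for separated functions -/

/-- Green's formula on the annulus for a smooth `W` that near the annulus has the separated form
`∂W/∂r = n B(r) x(θ) / r`, `∂W/∂θ = - n A(r) y(θ)` of a harmonic function, when `B(b) = 0`. -/
theorem green_smooth {a b : ℝ} (ha : 0 < a) (hab : a < b) {W φ : Plane → ℝ}
    (hφ : ContDiff ℝ (⊤ : ℕ∞) φ) {n : ℝ} {A B x y : ℝ → ℝ}
    (hx : ∀ θ, HasDerivAt x (-(n * y θ)) θ) (hy : ∀ θ, HasDerivAt y (n * x θ) θ)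
    (hper : y Real.pi = y (-Real.pi)) (hA : ContinuousOn A (Set.Icc a b))
    (hB : ∀ r ∈ Set.Icc a b, HasDerivAt B (n * (A r / r)) r) (hBb : B b = 0)
    (hWr : ∀ r ∈ Set.Ioo a b, ∀ θ,
      r * fderiv ℝ W (circlePoint r θ) (Real.cos θ, Real.sin θ) = n * B r * x θ)
    (hWθ : ∀ r ∈ Set.Ioo a b, ∀ θ,
      fderiv ℝ W (circlePoint r θ) (-(r * Real.sin θ), r * Real.cos θ) = -(n * A r * y θ)) :
    ∫ p in annulus a b, (fderiv ℝ W p (1, 0) * fderiv ℝ φ p (1, 0) +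
      fderiv ℝ W p (0, 1) * fderiv ℝ φ p (0, 1)) =
      -(n * B a) * ∫ θ in (-Real.pi)..Real.pi, x θ * φ (circlePoint a θ) := by
  have hxc : Continuous x := continuous_iff_continuousAt.2 fun θ => (hx θ).continuousAt
  have hyc : Continuous y := continuous_iff_continuousAt.2 fun θ => (hy θ).continuousAt
  have hφr := continuous_radial hφ
  have hφθ := continuous_angular hφ
  have hφc := hφ.continuous.comp continuous_circlePoint_uncurry
  have hAr : ContinuousOn (fun r => A r / r) (Set.Icc a b) :=
    hA.div continuousOn_id fun r hr => (ha.trans_le hr.1).ne'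
  have hBc : ContinuousOn B (Set.Icc a b) := fun r hr => (hB r hr).continuousAt.continuousWithinAt
  have hfst : Set.MapsTo Prod.fst (Set.Icc a b ×ˢ (Set.univ : Set ℝ)) (Set.Icc a b) :=
    fun p hp => hp.1
  have hAr' := hAr.comp continuousOn_fst hfst
  have hB' := hBc.comp continuousOn_fst hfst
  -- In polar coordinates `r ∇W · ∇φ = n B x φ_r - n (A/r) y φ_θ`. Adding and subtracting `n² (A/r)
  -- x φ` makes `G₁` the `r`-derivative of `n x B φ`, and `G₂` equal to `n (A/r)` times the
  -- `θ`-derivative of `y φ`.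
  let G₁ : ℝ × ℝ → ℝ := fun z => n * x z.2 *
    (B z.1 * fderiv ℝ φ (circlePoint z.1 z.2) (Real.cos z.2, Real.sin z.2) +
      n * (A z.1 / z.1) * φ (circlePoint z.1 z.2))
  let G₂ : ℝ × ℝ → ℝ := fun z => n * (A z.1 / z.1) *
    (y z.2 * fderiv ℝ φ (circlePoint z.1 z.2) (-(z.1 * Real.sin z.2), z.1 * Real.cos z.2) +
      n * x z.2 * φ (circlePoint z.1 z.2))
  have hG₁ : ContinuousOn G₁ (Set.Icc a b ×ˢ Set.univ) :=
    (by fun_prop : Continuous fun z : ℝ × ℝ => n * x z.2).continuousOn.mul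
      ((hB'.mul hφr.continuousOn).add ((continuousOn_const.mul hAr').mul hφc.continuousOn))
  have hG₂ : ContinuousOn G₂ (Set.Icc a b ×ˢ Set.univ) :=
    (continuousOn_const.mul hAr').mul
      (((hyc.comp continuous_snd).continuousOn.mul hφθ.continuousOn).add
        ((by fun_prop : Continuous fun z : ℝ × ℝ => n * x z.2).continuousOn.mul hφc.continuousOn))
  have hsplit : ∀ z ∈ Set.Ioo a b ×ˢ Set.Ioo (-Real.pi) Real.pi, z.1 *
      (fderiv ℝ W (circlePoint z.1 z.2) (1, 0) * fderiv ℝ φ (circlePoint z.1 z.2) (1, 0) +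
      fderiv ℝ W (circlePoint z.1 z.2) (0, 1) * fderiv ℝ φ (circlePoint z.1 z.2) (0, 1)) =
      G₁ z - G₂ z := by
    rintro ⟨r, θ⟩ ⟨hr, -⟩
    have hr0 : r ≠ 0 := (ha.trans hr.1).ne'
    have e1 := hWr r hr θ
    have e2 := hWθ r hr θ
    simp only [G₁, G₂]
    rw [fderiv_apply_prod] at e1 e2
    rw [fderiv_apply_prod φ _ (Real.cos θ), fderiv_apply_prod φ _ (-(r * Real.sin θ))]
    field_simp
    have hsc := Real.sin_sq_add_cos_sq θ
    set X := fderiv ℝ W (circlePoint r θ) (1, 0)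
    set Y := fderiv ℝ W (circlePoint r θ) (0, 1)
    set P := fderiv ℝ φ (circlePoint r θ) (1, 0)
    set Q := fderiv ℝ φ (circlePoint r θ) (0, 1)
    -- The radial and angular directions are orthogonal, so `r²` times the product of gradients is
    -- `r²` times the product of radial derivatives plus the product of angular derivatives.
    linear_combination (-(r ^ 2 * (X * P + Y * Q))) * hsc +
      r * (Real.cos θ * P + Real.sin θ * Q) * e1 +
      (-(r * Real.sin θ) * P + r * Real.cos θ * Q) * e2
  rw [integral_annulus ha hab, setIntegral_congr_fun (measurableSet_Ioo.prod measurableSet_Ioo)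
    hsplit, integral_sub (integrableOn_polar hG₁) (integrableOn_polar hG₂),
    setIntegral_polar' hab hG₁, setIntegral_polar hab hG₂]
  -- Only the endpoint `r = a` contributes, since `B b = 0` means zero flux through the outer
  -- circle.
  have i1 : ∀ θ, ∫ r in a..b, G₁ (r, θ) = -(n * B a) * (x θ * φ (circlePoint a θ)) := by
    intro θ
    have h := intervalIntegral.integral_eq_sub_of_hasDerivAt (a := a) (b := b)
      (f := fun r => B r * φ (circlePoint r θ))
      (f' := fun r => n * (A r / r) * φ (circlePoint r θ) +
        B r * fderiv ℝ φ (circlePoint r θ) (Real.cos θ, Real.sin θ))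
      (fun r hr => (hB r (by rwa [Set.uIcc_of_le hab.le] at hr)).mul (hasDerivAt_radial hφ r θ))
      (by
        refine ContinuousOn.intervalIntegrable ?_
        rw [Set.uIcc_of_le hab.le]
        have c1 : Continuous fun r => φ (circlePoint r θ) :=
          hφc.comp (continuous_id.prodMk continuous_const)
        have c2 : Continuous fun r => fderiv ℝ φ (circlePoint r θ) (Real.cos θ, Real.sin θ) :=
          hφr.comp (continuous_id.prodMk continuous_const)
        exact ((continuousOn_const.mul hAr).mul c1.continuousOn).add (hBc.mul c2.continuousOn))
    simp only [G₁]
    rw [intervalIntegral.integral_const_mul]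
    simp_rw [add_comm (B _ * _)]
    rw [h, hBb]
    ring
  -- The exact `θ`-derivative integrates to zero over a full period.
  have i2 : ∀ r, ∫ θ in (-Real.pi)..Real.pi, G₂ (r, θ) = 0 := by
    intro r
    have c1 : Continuous fun θ => φ (circlePoint r θ) :=
      hφc.comp (continuous_const.prodMk continuous_id)
    have c2 : Continuous fun θ =>
        fderiv ℝ φ (circlePoint r θ) (-(r * Real.sin θ), r * Real.cos θ) :=
      hφθ.comp (continuous_const.prodMk continuous_id)
    have h := intervalIntegral.integral_eq_sub_of_hasDerivAt (a := -Real.pi) (b := Real.pi)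
      (f := fun θ => y θ * φ (circlePoint r θ))
      (f' := fun θ => n * x θ * φ (circlePoint r θ) +
        y θ * fderiv ℝ φ (circlePoint r θ) (-(r * Real.sin θ), r * Real.cos θ))
      (fun θ _ => (hy θ).mul (hasDerivAt_angular hφ r θ))
      ((((continuous_const.mul hxc).mul c1).add (hyc.mul c2)).intervalIntegrable _ _)
    have hcp : circlePoint r Real.pi = circlePoint r (-Real.pi) := by simp [circlePoint]
    simp only [G₂]
    rw [intervalIntegral.integral_const_mul]
    simp_rw [add_comm (y _ * _)]
    rw [h, hper, hcp, sub_self, mul_zero]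
  simp_rw [i1, i2]
  rw [intervalIntegral.integral_const_mul, intervalIntegral.integral_zero, sub_zero]

/-! ### Trigonometric modes on a circle -/

/-- The trigonometric mode `Re (c e^{inθ})`. -/
noncomputable def phase (n : ℕ) (c : ℂ) (θ : ℝ) : ℝ := (c * Complex.exp (Complex.I * n * θ)).re

/-- A complex amplitude carries cosine and sine together; differentiation multiplies it by `i n`. -/
theorem hasDerivAt_phase (n : ℕ) (c : ℂ) (θ : ℝ) :
    HasDerivAt (phase n c) (n * phase n (Complex.I * c) θ) θ := by
  have h1 : HasDerivAt (fun θ : ℝ => Complex.I * n * (θ : ℂ)) (Complex.I * n) θ := by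
    simpa using (Complex.ofRealCLM.hasDerivAt (x := θ)).const_mul (Complex.I * n)
  have h2 := Complex.reCLM.hasFDerivAt.comp_hasDerivAt θ (h1.cexp.const_mul c)
  refine h2.congr_deriv ?_
  simp only [phase, Complex.reCLM_apply]
  rw [← Complex.re_ofReal_mul]
  congr 1
  push_cast
  ring

theorem continuous_phase (n : ℕ) (c : ℂ) : Continuous (phase n c) :=
  continuous_iff_continuousAt.2 fun θ => (hasDerivAt_phase n c θ).continuousAt

theorem phase_neg (n : ℕ) (c : ℂ) (θ : ℝ) : phase n (-c) θ = -phase n c θ := by simp [phase]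

theorem phase_pi (n : ℕ) (c : ℂ) : phase n c Real.pi = phase n c (-Real.pi) := by
  have h : Complex.exp (Complex.I * n * (Real.pi : ℂ)) =
      Complex.exp (Complex.I * n * ((-Real.pi : ℝ) : ℂ)) := by
    rw [Complex.exp_eq_exp_iff_exists_int]
    exact ⟨n, by push_cast; ring⟩
  rw [phase, phase, h]

/-- The modes `f`, `g` are eigenfunctions of the second derivative with eigenvalues `-n²`, `-m²`.
The Wronskian `f' g - f g'` is periodic and has derivative `(m² - n²) f g`. -/
theorem integral_phase_mul_phase {n m : ℕ} (hnm : n ≠ m) (c d : ℂ) :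
    ∫ θ in (-Real.pi)..Real.pi, phase n c θ * phase m d θ = 0 := by
  have hII : ∀ (k : ℕ) (e : ℂ) (θ : ℝ), phase k (Complex.I * (Complex.I * e)) θ = -phase k e θ := by
    intro k e θ
    rw [← mul_assoc, Complex.I_mul_I, neg_one_mul, phase_neg]
  have hc1 := continuous_phase n c
  have hc2 := continuous_phase m d
  have h := intervalIntegral.integral_eq_sub_of_hasDerivAt (a := -Real.pi) (b := Real.pi)
    (f := fun θ => n * phase n (Complex.I * c) θ * phase m d θ -
      phase n c θ * (m * phase m (Complex.I * d) θ))
    (f' := fun θ => ((m : ℝ) ^ 2 - n ^ 2) * (phase n c θ * phase m d θ))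
    (fun θ _ => by
      refine ((((hasDerivAt_phase n (Complex.I * c) θ).const_mul (n : ℝ)).mul
        (hasDerivAt_phase m d θ)).sub ((hasDerivAt_phase n c θ).mul
        ((hasDerivAt_phase m (Complex.I * d) θ).const_mul (m : ℝ)))).congr_deriv ?_
      rw [hII, hII]
      ring)
    ((by fun_prop : Continuous _).intervalIntegrable _ _)
  rw [intervalIntegral.integral_const_mul] at h
  simp only [phase_pi, sub_self] at h
  refine (mul_eq_zero.1 h).resolve_left ?_
  intro h2
  rw [sub_eq_zero, pow_left_inj₀ (Nat.cast_nonneg m) (Nat.cast_nonneg n) two_ne_zero] at h2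
  exact hnm (by exact_mod_cast h2.symm)

/-- The extension `Re (c (z / R)^n)` to the plane of the mode `Re (c e^{inθ})` on the circle of
radius `R`. -/
noncomputable def circleModeFun (R : ℝ) (n : ℕ) (c : ℂ) (p : Plane) : ℝ :=
  (c * (((p.1 : ℂ) + p.2 * Complex.I) / R) ^ n).re

theorem continuous_circleModeFun (R : ℝ) (n : ℕ) (c : ℂ) : Continuous (circleModeFun R n c) := by
  unfold circleModeFun
  refine Complex.continuous_re.comp (continuous_const.mul (Continuous.pow ?_ n))
  refine Continuous.div_const ?_ _
  exact (Complex.continuous_ofReal.comp continuous_fst).add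
    ((Complex.continuous_ofReal.comp continuous_snd).mul continuous_const)

theorem circlePoint_toComplex (R θ : ℝ) :
    ((circlePoint R θ).1 : ℂ) + (circlePoint R θ).2 * Complex.I =
      R * Complex.exp (θ * Complex.I) := by
  rw [Complex.exp_mul_I]
  simp only [circlePoint]
  push_cast
  ring

theorem exp_mul_I_pow (n : ℕ) (θ : ℝ) :
    Complex.exp (θ * Complex.I) ^ n = Complex.exp (Complex.I * n * θ) := by
  rw [← Complex.exp_nat_mul]
  ring_nf

theorem circleModeFun_circlePoint {R : ℝ} (hR : R ≠ 0) (n : ℕ) (c : ℂ) (θ : ℝ) :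
    circleModeFun R n c (circlePoint R θ) = phase n c θ := by
  rw [circleModeFun, circlePoint_toComplex, mul_div_cancel_left₀ _ (Complex.ofReal_ne_zero.2 hR),
    exp_mul_I_pow, phase]

/-- The mode `Re (c e^{inθ})` in `L²` of the circle of radius `R`. -/
noncomputable def circleMode (R : ℝ) (n : ℕ) (c : ℂ) : L2 (arcMeasure R) :=
  (memLp_arcMeasure R (continuous_circleModeFun R n c)).toLp _

theorem coeFn_circleMode (R : ℝ) (n : ℕ) (c : ℂ) :
    circleMode R n c =ᵐ[arcMeasure R] circleModeFun R n c :=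
  MemLp.coeFn_toLp _

theorem inner_circleMode {R : ℝ} (hR : 0 < R) (f : L2 (arcMeasure R)) (n : ℕ) (c : ℂ) :
    inner ℝ f (circleMode R n c) =
      R * ∫ θ in (-Real.pi)..Real.pi, f (circlePoint R θ) * phase n c θ := by
  rw [inner_eq_integral (EventuallyEq.refl _ (f : Plane → ℝ)) (coeFn_circleMode R n c),
    integral_arcMeasure hR (w := fun p => f p * circleModeFun R n c p)
      ((Lp.aestronglyMeasurable f).mul
      (continuous_circleModeFun R n c).aestronglyMeasurable)]
  simp_rw [circleModeFun_circlePoint hR.ne']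

theorem inner_circleMode_circleMode {R : ℝ} (hR : 0 < R) (n m : ℕ) (c d : ℂ) :
    inner ℝ (circleMode R n c) (circleMode R m d) =
      R * ∫ θ in (-Real.pi)..Real.pi, phase n c θ * phase m d θ := by
  rw [inner_eq_integral (coeFn_circleMode R n c) (coeFn_circleMode R m d), integral_arcMeasure hR
    (w := fun p => circleModeFun R n c p * circleModeFun R m d p)
    ((continuous_circleModeFun R n c).mul (continuous_circleModeFun R m d)).aestronglyMeasurable]
  simp_rw [circleModeFun_circlePoint hR.ne']

/-! ### Harmonic modes in the annulus -/

/-- A smooth function on the line that equals `1 / s` for `s ≥ a²`. -/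
noncomputable def smoothInv (a s : ℝ) : ℝ := Real.smoothTransition (2 * s / a ^ 2 - 1) / s

theorem smoothInv_of_le {a s : ℝ} (ha : 0 < a) (h : a ^ 2 ≤ s) : smoothInv a s = 1 / s := by
  rw [smoothInv, Real.smoothTransition.one_of_one_le]
  have h2 : 1 ≤ s / a ^ 2 := (one_le_div (pow_pos ha 2)).2 h
  have h3 : 2 * s / a ^ 2 = 2 * (s / a ^ 2) := mul_div_assoc _ _ _
  linarith

/-- The functions in `smoothGraph` are smooth on the whole plane, so `1 / s` has to be altered near
the origin. The transition vanishes for `s ≤ a² / 2` and is `1` for `s ≥ a²`, which leaves the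
closed annulus untouched. -/
theorem contDiff_smoothInv {a : ℝ} (ha : 0 < a) : ContDiff ℝ (⊤ : ℕ∞) (smoothInv a) := by
  rw [contDiff_iff_contDiffAt]
  intro s
  by_cases hs : s = 0
  · have h0 : smoothInv a =ᶠ[𝓝 s] fun _ => 0 := by
      have hlt : s < a ^ 2 / 2 := by rw [hs]; positivity
      filter_upwards [Iio_mem_nhds hlt] with t ht
      rw [smoothInv, Real.smoothTransition.zero_of_nonpos, zero_div]
      have h2 : 2 * t / a ^ 2 ≤ 1 := (div_le_one (pow_pos ha 2)).2 (by
        have : t < a ^ 2 / 2 := ht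
        linarith)
      linarith
    exact contDiffAt_const.congr_of_eventuallyEq h0
  · have h1 : ContDiffAt ℝ (⊤ : ℕ∞) (fun s : ℝ => 2 * s / a ^ 2 - 1) s := by fun_prop
    exact (Real.smoothTransition.contDiffAt.comp s h1).div contDiffAt_id hs

/-- A smooth function on the plane that on the closed annulus is the harmonic function
`(r^n + b^(2n) r^(-n)) / (a^n + b^(2n) a^(-n)) Re (c e^{inθ})`. -/
noncomputable def harmonicMode (a b : ℝ) (n : ℕ) (c : ℂ) (p : Plane) : ℝ :=
  (c * (((p.1 : ℂ) + p.2 * Complex.I) ^ n + (((b ^ 2 * smoothInv a (p.1 ^ 2 + p.2 ^ 2) : ℝ) : ℂ) *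
    ((p.1 : ℂ) + p.2 * Complex.I)) ^ n)).re / (a ^ n + (b ^ 2 / a) ^ n)

theorem contDiff_harmonicMode {a : ℝ} (ha : 0 < a) (b : ℝ) (n : ℕ) (c : ℂ) :
    ContDiff ℝ (⊤ : ℕ∞) (harmonicMode a b n c) := by
  have h1 : ContDiff ℝ (⊤ : ℕ∞) fun p : Plane => ((p.1 : ℂ) + p.2 * Complex.I) :=
    (Complex.ofRealCLM.contDiff.comp contDiff_fst).add
      ((Complex.ofRealCLM.contDiff.comp contDiff_snd).mul contDiff_const)
  have h2 : ContDiff ℝ (⊤ : ℕ∞) fun p : Plane => p.1 ^ 2 + p.2 ^ 2 := by fun_prop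
  have h3 : ContDiff ℝ (⊤ : ℕ∞) fun p : Plane =>
      ((b ^ 2 * smoothInv a (p.1 ^ 2 + p.2 ^ 2) : ℝ) : ℂ) :=
    Complex.ofRealCLM.contDiff.comp (contDiff_const.mul ((contDiff_smoothInv ha).comp h2))
  exact (Complex.reCLM.contDiff.comp
    (contDiff_const.mul ((h1.pow n).add ((h3.mul h1).pow n)))).div_const _

/-- The point `b² z / |z|²` is the reflection of `z` in the outer circle: same angle, modulus `b² /
r`. Symmetry under this reflection is what makes the flux at `r = b` vanish. -/
theorem harmonicMode_circlePoint {a : ℝ} (ha : 0 < a) (b : ℝ) (n : ℕ) (c : ℂ) {r : ℝ} (hr : a ≤ r)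
    (θ : ℝ) : harmonicMode a b n c (circlePoint r θ) =
      (r ^ n + (b ^ 2 / r) ^ n) / (a ^ n + (b ^ 2 / a) ^ n) * phase n c θ := by
  have hr0 : r ≠ 0 := (ha.trans_le hr).ne'
  have hcp : (circlePoint r θ).1 ^ 2 + (circlePoint r θ).2 ^ 2 = r ^ 2 := by
    simp only [circlePoint]
    linear_combination r ^ 2 * Real.sin_sq_add_cos_sq θ
  rw [harmonicMode, hcp, circlePoint_toComplex,
    smoothInv_of_le ha (pow_le_pow_left₀ ha.le hr 2), ← mul_assoc, ← Complex.ofReal_mul]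
  have e : b ^ 2 * (1 / r ^ 2) * r = b ^ 2 / r := by field_simp
  rw [e, mul_pow, mul_pow, ← add_mul, exp_mul_I_pow, mul_left_comm, ← Complex.ofReal_pow,
    ← Complex.ofReal_pow, ← Complex.ofReal_add, Complex.re_ofReal_mul, phase]
  ring

/-- The ratio of the outer trace to the inner trace of the harmonic function with the mode `n` on
the inner circle and zero flux through the outer circle. -/
noncomputable def transferCoeff (a b : ℝ) (n : ℕ) : ℝ := 2 * b ^ n / (a ^ n + (b ^ 2 / a) ^ n)

/-- The operator `r d/dr` multiplies `r^n` by `n` and `(b²/r)^n` by `-n`, so it exchanges the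
profiles with `ε = 1` and `ε = -1` up to the factor `n`. -/
theorem hasDerivAt_radial_profile (b d : ℝ) (n : ℕ) {r : ℝ} (hr : r ≠ 0) (ε : ℝ) :
    HasDerivAt (fun r : ℝ => (r ^ n + ε * (b ^ 2 / r) ^ n) / d)
      (n * ((r ^ n - ε * (b ^ 2 / r) ^ n) / d / r)) r := by
  have h1 : HasDerivAt (fun r : ℝ => r ^ n) (n * (r ^ n / r)) r := by
    refine (hasDerivAt_pow n r).congr_deriv ?_
    cases n with
    | zero => simp
    | succ k => rw [Nat.add_sub_cancel, pow_succ, mul_div_cancel_right₀ _ hr]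
  have h0 : HasDerivAt (fun r : ℝ => b ^ 2 / r) (-(b ^ 2 / r ^ 2)) r := by
    refine ((hasDerivAt_const r (b ^ 2)).div (hasDerivAt_id r) hr).congr_deriv ?_
    simp [neg_div]
  have h2 : HasDerivAt (fun r : ℝ => (b ^ 2 / r) ^ n) (-(n * ((b ^ 2 / r) ^ n / r))) r := by
    refine (h0.pow n).congr_deriv ?_
    cases n with
    | zero => simp
    | succ k =>
      rw [Nat.add_sub_cancel, pow_succ (b ^ 2 / r)]
      generalize (b ^ 2 / r) ^ k = t
      field_simp
  refine ((h1.add (h2.const_mul ε)).div_const d).congr_deriv ?_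
  ring

/-- An identity between continuous functions passes from smooth functions to `H¹`. -/
theorem HasTrace.eq_of_smooth {a b : ℝ}
    {F K : Jet (annulus a b) × L2 (arcMeasure a) × L2 (arcMeasure b) → ℝ} (hF : Continuous F)
    (hK : Continuous K) (hFK : ∀ x ∈ smoothGraph a b, F x = K x) {v : H1 (annulus a b)}
    {f : L2 (arcMeasure a)} {g : L2 (arcMeasure b)} (h : HasTrace a b v f g) :
    F (v.1, f, g) = K (v.1, f, g) :=
  le_antisymm (h.le_of_smooth hF hK fun x hx => (hFK x hx).le)
    (h.le_of_smooth hK hF fun x hx => (hFK x hx).ge)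

theorem green_harmonicMode {a b : ℝ} (ha : 0 < a) (hab : a < b) (n : ℕ) (c : ℂ) {φ : Plane → ℝ}
    (hφ : ContDiff ℝ (⊤ : ℕ∞) φ) :
    ∫ p in annulus a b,
      (fderiv ℝ (harmonicMode a b n c) p (1, 0) * fderiv ℝ φ p (1, 0) +
        fderiv ℝ (harmonicMode a b n c) p (0, 1) * fderiv ℝ φ p (0, 1)) =
      -(n * ((a ^ n - (b ^ 2 / a) ^ n) / (a ^ n + (b ^ 2 / a) ^ n))) *
        ∫ θ in (-Real.pi)..Real.pi, phase n c θ * φ (circlePoint a θ) := by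
  have hW := contDiff_harmonicMode ha b n c
  have hb := ha.trans hab
  set d := a ^ n + (b ^ 2 / a) ^ n with hd
  have hA : ∀ r : ℝ, r ≠ 0 → HasDerivAt (fun r : ℝ => (r ^ n + (b ^ 2 / r) ^ n) / d)
      (n * ((r ^ n - (b ^ 2 / r) ^ n) / d / r)) r := fun r hr => by
    simpa only [one_mul] using hasDerivAt_radial_profile b d n hr 1
  have hB : ∀ r : ℝ, r ≠ 0 → HasDerivAt (fun r : ℝ => (r ^ n - (b ^ 2 / r) ^ n) / d)
      (n * ((r ^ n + (b ^ 2 / r) ^ n) / d / r)) r := fun r hr => by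
    simpa only [neg_one_mul, sub_neg_eq_add, ← sub_eq_add_neg] using
      hasDerivAt_radial_profile b d n hr (-1)
  -- `B` and `y` are the radial and angular factors of the conjugate harmonic function; `B` vanishes
  -- at `b` because `b² / b = b`.
  refine green_smooth ha hab hφ (n := n) (A := fun r => (r ^ n + (b ^ 2 / r) ^ n) / d)
    (B := fun r => (r ^ n - (b ^ 2 / r) ^ n) / d) (x := phase n c)
    (y := phase n (-(Complex.I * c))) ?_ ?_ (phase_pi _ _) ?_ ?_ ?_ ?_ ?_
  · intro θ
    simpa only [phase_neg, mul_neg, neg_neg] using hasDerivAt_phase n c θ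
  · intro θ
    have h := hasDerivAt_phase n (-(Complex.I * c)) θ
    rwa [mul_neg, ← mul_assoc, Complex.I_mul_I, neg_one_mul, neg_neg] at h
  · exact fun r hr => (hA r (ha.trans_le hr.1).ne').continuousAt.continuousWithinAt
  · exact fun r hr => hB r (ha.trans_le hr.1).ne'
  · have : b ^ 2 / b = b := by field_simp
    simp [this]
  · intro r hr θ
    have hr0 : r ≠ 0 := (ha.trans hr.1).ne'
    have h1 := hasDerivAt_radial hW r θ
    have h2 : HasDerivAt (fun r => harmonicMode a b n c (circlePoint r θ))
        (n * ((r ^ n - (b ^ 2 / r) ^ n) / d / r) * phase n c θ) r := by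
      refine ((hA r hr0).mul_const (phase n c θ)).congr_of_eventuallyEq ?_
      filter_upwards [Ioi_mem_nhds hr.1] with s hs
      exact harmonicMode_circlePoint ha b n c (le_of_lt hs) θ
    rw [h1.unique h2]
    field_simp
  · intro r hr θ
    have h1 := hasDerivAt_angular hW r θ
    have h2 : HasDerivAt (fun θ => harmonicMode a b n c (circlePoint r θ))
        ((r ^ n + (b ^ 2 / r) ^ n) / d * (n * phase n (Complex.I * c) θ)) θ := by
      refine ((hasDerivAt_phase n c θ).const_mul _).congr_of_eventuallyEq ?_
      exact Eventually.of_forall fun t => harmonicMode_circlePoint ha b n c hr.1.le t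
    rw [h1.unique h2, phase_neg]
    ring

/-- The modes are exact solutions of the primary problem with zero flux. -/
theorem exists_isPrimarySolution_mode {a b : ℝ} (ha : 0 < a) (hab : a < b) (n : ℕ) (c : ℂ) :
    ∃ v : H1 (annulus a b), IsPrimarySolution (0 : HalfOuter a b →ₗ[ℝ] ℝ) (circleMode a n c) v
      (transferCoeff a b n • circleMode b n c) := by
  have hW := contDiff_harmonicMode ha b n c
  have hb := ha.trans hab
  have hd : 0 < a ^ n + (b ^ 2 / a) ^ n := by positivity
  have hf : circleMode a n c =ᵐ[arcMeasure a] harmonicMode a b n c := by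
    refine (coeFn_circleMode a n c).trans (ae_eq_of_eq_circlePoint ha
      (continuous_circleModeFun a n c) hW.continuous fun θ => ?_)
    rw [circleModeFun_circlePoint ha.ne', harmonicMode_circlePoint ha b n c le_rfl,
      div_self hd.ne', one_mul]
  have hg : (transferCoeff a b n • circleMode b n c : L2 (arcMeasure b)) =ᵐ[arcMeasure b]
      harmonicMode a b n c := by
    refine (Lp.coeFn_smul _ _).trans (EventuallyEq.trans
      ((coeFn_circleMode b n c).const_smul (transferCoeff a b n)) (ae_eq_of_eq_circlePoint hb
        ((continuous_circleModeFun b n c).const_smul _) hW.continuous fun θ => ?_))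
    have e : b ^ 2 / b = b := by field_simp
    rw [Pi.smul_apply, circleModeFun_circlePoint hb.ne', harmonicMode_circlePoint ha b n c hab.le,
      e, smul_eq_mul, transferCoeff, two_mul]
  obtain ⟨v, hv, h1, h2⟩ := exists_smooth_hasTrace a b hW hf hg
  refine ⟨v, hv, fun φ γ hφ => ?_⟩
  rw [LinearMap.zero_apply]
  -- `κ` times the mode is the outward normal derivative on the inner circle; the division by `a`
  -- passes from `dθ` to arc length. Test functions with zero inner trace do not see it.
  set κ := -(n * ((a ^ n - (b ^ 2 / a) ^ n) / (a ^ n + (b ^ 2 / a) ^ n))) / a with hκ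
  have key := hφ.eq_of_smooth
    (F := fun x => inner ℝ v.1.2.1 x.1.2.1 + inner ℝ v.1.2.2 x.1.2.2)
    (K := fun x => κ * inner ℝ (circleMode a n c) x.2.1) (by fun_prop) (by fun_prop) (by
      rintro x ⟨z, hz, -, k1, k2, k3, -⟩
      rw [inner_add_inner_eq_integral h1 k1 h2 k2, green_harmonicMode ha hab n c hz,
        inner_eq_integral (coeFn_circleMode a n c) k3, integral_arcMeasure ha
          (w := fun p => circleModeFun a n c p * z p)
          ((continuous_circleModeFun a n c).mul hz.continuous).aestronglyMeasurable]
      simp_rw [circleModeFun_circlePoint ha.ne']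
      rw [hκ]
      field_simp)
  simpa only [inner_zero_right, mul_zero] using! key

/-! ### Completeness of the modes -/

/-- For negative `j`, conjugation reverses the frequency and keeps the real part. -/
theorem exists_phase_eq (j : ℤ) (c : ℂ) :
    ∃ d : ℂ, ∀ θ : ℝ, (c * Complex.exp (Complex.I * j * θ)).re = phase j.natAbs d θ := by
  obtain h | h := Int.natAbs_eq j
  · refine ⟨c, fun θ => ?_⟩
    rw [phase]
    nth_rw 1 [h]
    rw [Int.cast_natCast]
  · refine ⟨(starRingEnd ℂ) c, fun θ => ?_⟩
    rw [phase, ← Complex.conj_re]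
    congr 1
    rw [map_mul, ← Complex.exp_conj]
    nth_rw 1 [h]
    simp

theorem memLp_comp_circlePoint {R : ℝ} (hR : 0 < R) (f : L2 (arcMeasure R)) :
    MemLp (fun θ => f (circlePoint R θ)) 2 (volume.restrict (Set.Ioc (-Real.pi) Real.pi)) := by
  have h : MemLp (f ∘ circlePoint R) 2
      (ENNReal.ofReal R • volume.restrict (Set.Ioc (-Real.pi) Real.pi)) :=
    (memLp_map_measure_iff (Lp.aestronglyMeasurable f)
      (continuous_circlePoint R).measurable.aemeasurable).1 (Lp.memLp f)
  have hR' : ENNReal.ofReal R ≠ 0 := by simpa using hR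
  refine h.of_measure_le_smul (c := (ENNReal.ofReal R)⁻¹) (ENNReal.inv_ne_top.2 hR') ?_
  rw [smul_smul, ENNReal.inv_mul_cancel hR' ENNReal.ofReal_ne_top, one_smul]

/-- The modes are complete in `L²` of the circle. -/
theorem eq_zero_of_inner_circleMode {R : ℝ} (hR : 0 < R) (f : L2 (arcMeasure R))
    (h : ∀ n c, inner ℝ f (circleMode R n c) = 0) : f = 0 := by
  have hpi : -Real.pi < Real.pi := by linarith [Real.pi_pos]
  have hf := memLp_comp_circlePoint hR f
  let F : ℝ → ℂ := fun θ => (f (circlePoint R θ) : ℂ)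
  have hF : MemLp F 2 (volume.restrict (Set.Ioc (-Real.pi) Real.pi)) := hf.ofReal
  have hcoef : ∀ j : ℤ, fourierCoeffOn hpi F j = 0 := by
    intro j
    rw [fourierCoeffOn_eq_integral]
    set z := ∫ x in (-Real.pi)..Real.pi,
      fourier (-j) (x : AddCircle (Real.pi - -Real.pi)) • F x with hz
    -- The choice `c = conj z` yields `|z|² = 0`; the real parts of `c * z` are, up to the factor
    -- `R`, inner products of `f` with modes.
    suffices hre : ∀ c : ℂ, (c * z).re = 0 by
      have h1 := hre ((starRingEnd ℂ) z)
      rw [mul_comm, Complex.mul_conj, Complex.ofReal_re] at h1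
      rw [Complex.normSq_eq_zero.1 h1, smul_zero]
    intro c
    obtain ⟨d, hd⟩ := exists_phase_eq (-j) c
    have hint : IntegrableOn (fun x : ℝ => c * (fourier (-j) (x : AddCircle (Real.pi - -Real.pi)) •
        F x)) (Set.Ioc (-Real.pi) Real.pi) := by
      refine Integrable.const_mul ?_ c
      have hc : Continuous fun x : ℝ => fourier (-j) (x : AddCircle (Real.pi - -Real.pi)) :=
        (map_continuous _).comp (AddCircle.continuous_mk' _)
      exact (hF.integrable one_le_two).bdd_mul (c := 1) hc.aestronglyMeasurable
        (Eventually.of_forall fun x => by rw [fourier_apply]; exact (Circle.norm_coe _).le)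
    have hval := h (-j).natAbs d
    rw [inner_circleMode hR] at hval
    have hval' := (mul_eq_zero.1 hval).resolve_left hR.ne'
    rw [hz, ← intervalIntegral.integral_const_mul, intervalIntegral.integral_of_le hpi.le]
    have hcomm := Complex.reCLM.integral_comp_comm hint
    rw [Complex.reCLM_apply] at hcomm
    rw [← hcomm, ← intervalIntegral.integral_of_le hpi.le, ← hval']
    refine intervalIntegral.integral_congr fun θ _ => ?_
    simp only [Complex.reCLM_apply, F]
    rw [← hd, fourier_coe_apply, smul_eq_mul, ← mul_assoc, Complex.re_mul_ofReal, mul_comm]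
    congr 4
    have hp : (Real.pi : ℂ) ≠ 0 := Complex.ofReal_ne_zero.2 Real.pi_ne_zero
    push_cast
    field_simp
    ring
  -- Parseval's identity: all coefficients vanish, hence so does the integral of `‖F‖²`.
  have hsum := tsum_sq_fourierCoeffOn hpi hF
  simp only [hcoef, norm_zero, ne_eq, OfNat.ofNat_ne_zero, not_false_eq_true, zero_pow,
    tsum_zero] at hsum
  have hpos : (Real.pi - -Real.pi)⁻¹ ≠ 0 := inv_ne_zero (by linarith [Real.pi_pos])
  have h0 := (smul_eq_zero.1 hsum.symm).resolve_left hpos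
  have hnorm : ‖f‖ ^ 2 = 0 := by
    rw [← real_inner_self_eq_norm_sq, inner_eq_integral (EventuallyEq.refl _ (f : Plane → ℝ))
      (EventuallyEq.refl _ (f : Plane → ℝ)), integral_arcMeasure hR (w := fun p => f p * f p)
      ((Lp.aestronglyMeasurable f).mul (Lp.aestronglyMeasurable f))]
    have e : ∀ θ, f (circlePoint R θ) * f (circlePoint R θ) = ‖F θ‖ ^ 2 := fun θ => by
      simp only [F, Complex.norm_real, Real.norm_eq_abs, pow_two, abs_mul_abs_self]
    simp_rw [e]
    rw [h0, mul_zero]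
  exact norm_eq_zero.1 (pow_eq_zero_iff two_ne_zero |>.1 hnorm)

theorem inner_circleMode_of_ne {R : ℝ} (hR : 0 < R) {n m : ℕ} (hnm : n ≠ m) (c d : ℂ) :
    inner ℝ (circleMode R n c) (circleMode R m d) = 0 := by
  rw [inner_circleMode_circleMode hR, integral_phase_mul_phase hnm, mul_zero]

/-! ### Uniqueness of the outer trace and the value of the cost -/

theorem dirichletForm_comm {Ω : Set Plane} (v w : H1 Ω) : dirichletForm v w = dirichletForm w v := by
  rw [dirichletForm, dirichletForm, real_inner_comm, real_inner_comm v.1.2.2]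

theorem dirichletForm_add_smul {Ω : Set Plane} (v w φ : H1 Ω) (t : ℝ) :
    dirichletForm (v + t • w) φ = dirichletForm v φ + t * dirichletForm w φ := by
  change inner ℝ (v.1.2.1 + t • w.1.2.1) φ.1.2.1 + inner ℝ (v.1.2.2 + t • w.1.2.2) φ.1.2.2 = _
  rw [inner_add_left, inner_add_left, real_inner_smul_left, real_inner_smul_left, dirichletForm,
    dirichletForm]
  ring

theorem IsPrimarySolution.add_smul {a b : ℝ} {q q' : HalfOuter a b →ₗ[ℝ] ℝ}
    {ω ω' : L2 (arcMeasure a)} {v v' : H1 (annulus a b)} {g g' : L2 (arcMeasure b)}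
    (h : IsPrimarySolution q ω v g) (t : ℝ) (h' : IsPrimarySolution q' ω' v' g') :
    IsPrimarySolution (q + t • q') (ω + t • ω') (v + t • v') (g + t • g') := by
  refine ⟨h.1.add (h'.1.smul t), fun φ γ hφ => ?_⟩
  rw [dirichletForm_add_smul, h.2 φ γ hφ, h'.2 φ γ hφ]
  rfl

/-- A solution with zero inner trace is an admissible test function for itself, so its Dirichlet
integral is zero and the trace inequality bounds the outer trace by zero. -/
theorem IsPrimarySolution.outer_eq_zero {a b : ℝ} (ha : 0 < a) (hab : a < b)
    {v : H1 (annulus a b)} {g : L2 (arcMeasure b)}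
    (h : IsPrimarySolution (0 : HalfOuter a b →ₗ[ℝ] ℝ) 0 v g) : g = 0 := by
  have h1 := h.2 v g h.1
  have h2 := trace_inequality ha hab h.1
  rw [h1, LinearMap.zero_apply, norm_zero] at h2
  have h3 : a * ‖g‖ ^ 2 ≤ 0 := by simpa using h2
  have h4 : ‖g‖ ^ 2 ≤ 0 := nonpos_of_mul_nonpos_right h3 ha
  exact norm_eq_zero.1 (pow_eq_zero_iff two_ne_zero |>.1 (le_antisymm h4 (sq_nonneg _)))

theorem IsPrimarySolution.outer_unique {a b : ℝ} (ha : 0 < a) (hab : a < b)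
    {q : HalfOuter a b →ₗ[ℝ] ℝ} {ω : L2 (arcMeasure a)} {v v' : H1 (annulus a b)}
    {g g' : L2 (arcMeasure b)} (h : IsPrimarySolution q ω v g) (h' : IsPrimarySolution q ω v' g') :
    g = g' := by
  have h1 := h.add_smul (-1) h'
  have eq : q + (-1 : ℝ) • q = 0 := by ext; simp
  have eω : ω + (-1 : ℝ) • ω = 0 := by simp
  have eg : g + (-1 : ℝ) • g' = g - g' := by simp [sub_eq_add_neg]
  rw [eq, eω, eg] at h1
  exact sub_eq_zero.1 (h1.outer_eq_zero ha hab)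

theorem integral_abs_sq {m : Measure Plane} (f : L2 m) : ∫ p, |f p| ^ 2 ∂m = ‖f‖ ^ 2 := by
  rw [← real_inner_self_eq_norm_sq, inner_eq_integral (EventuallyEq.refl _ (f : Plane → ℝ))
    (EventuallyEq.refl _ (f : Plane → ℝ))]
  simp_rw [sq_abs, pow_two]

/-- All solutions share one outer trace, so every member of the infimum has the same value. -/
theorem costJ_eq {a b : ℝ} (ha : 0 < a) (hab : a < b) {u : HalfOuter a b}
    {q : HalfOuter a b →ₗ[ℝ] ℝ} {ω : HalfInner a b} {v : H1 (annulus a b)} {g : L2 (arcMeasure b)}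
    (h : IsPrimarySolution q ω.1 v g) : costJ u q ω = ENNReal.ofReal (‖g - u.1‖ ^ 2) := by
  unfold costJ
  simp_rw [integral_abs_sq]
  refine le_antisymm (iInf_le_of_le v (iInf_le_of_le g (iInf_le _ h))) ?_
  refine le_iInf fun v' => le_iInf fun g' => le_iInf fun h' => ?_
  rw [h.outer_unique ha hab h']

/-- At an exact boundary value the primary solution attains the Dirichlet datum on the outer
circle. -/
theorem exists_primary_of_minimizer {a b : ℝ} (ha : 0 < a) (hab : a < b) {u : HalfOuter a b}
    {q : HalfOuter a b →ₗ[ℝ] ℝ} (hdata : IsCauchyData u q) {ωstar : HalfInner a b}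
    (hstar : costJ u q ωstar = ⨅ ω : HalfInner a b, costJ u q ω) :
    ∃ v, IsPrimarySolution q ωstar.1 v u.1 := by
  obtain ⟨-, ω₀, v₀, h₀⟩ := hdata
  have hz : costJ u q ωstar = 0 := by
    refine le_antisymm ?_ bot_le
    rw [hstar]
    refine iInf_le_of_le ω₀ ?_
    rw [costJ_eq ha hab h₀, sub_self]
    simp
  -- Without a solution the infimum that defines the cost is over an empty family and equals `⊤`,
  -- which contradicts `hz`.
  obtain ⟨v, g, h⟩ : ∃ v g, IsPrimarySolution q ωstar.1 v g := by
    by_contra! hne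
    have htop : costJ u q ωstar = ⊤ := by
      unfold costJ
      simp only [iInf_eq_top]
      exact fun v g h => absurd h (hne v g)
    rw [hz] at htop
    exact ENNReal.zero_ne_top htop
  rw [costJ_eq ha hab h, ENNReal.ofReal_eq_zero] at hz
  have h1 : ‖g - u.1‖ = 0 :=
    pow_eq_zero_iff two_ne_zero |>.1 (le_antisymm hz (sq_nonneg _))
  rw [sub_eq_zero.1 (norm_eq_zero.1 h1)] at h
  exact ⟨v, h⟩

/-! ### The gradient tested against zero-flux solutions -/

/-- On the line `ω + t δ` the cost is the quadratic polynomial `‖(g - u) + t h‖²`. Its derivative at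
`t = 0` is read off once from the coefficients and once from the first variation, whose remainder
along the line is `o(t)`. -/
theorem IsFirstVariation.inner_eq {a b : ℝ} (ha : 0 < a) (hab : a < b) {u : HalfOuter a b}
    {q : HalfOuter a b →ₗ[ℝ] ℝ} {ω : HalfInner a b} {G : L2 (arcMeasure a)}
    (hG : IsFirstVariation u q ω G) {v w : H1 (annulus a b)} {g h : L2 (arcMeasure b)}
    {δ : L2 (arcMeasure a)} (hv : IsPrimarySolution q ω.1 v g)
    (hw : IsPrimarySolution (0 : HalfOuter a b →ₗ[ℝ] ℝ) δ w h) :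
    inner ℝ G δ = 2 * inner ℝ (g - u.1) h := by
  let δ' : HalfInner a b := ⟨δ, w, h, hw.1⟩
  have hsol : ∀ t : ℝ, IsPrimarySolution q (ω + t • δ' : HalfInner a b).1 (v + t • w) (g + t • h) :=
    fun t => by simpa only [smul_zero, add_zero] using! hv.add_smul t hw
  have hJ : ∀ t : ℝ, (costJ u q (ω + t • δ')).toReal = ‖(g - u.1) + t • h‖ ^ 2 := fun t => by
    rw [costJ_eq ha hab (hsol t), ENNReal.toReal_ofReal (sq_nonneg _), add_sub_right_comm]
  have hJ0 : (costJ u q ω).toReal = ‖g - u.1‖ ^ 2 := by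
    rw [costJ_eq ha hab hv, ENNReal.toReal_ofReal (sq_nonneg _)]
  let K : ℝ → ℝ := fun t => ‖(g - u.1) + t • h‖ ^ 2
  have hK : ∀ t, K t = ‖g - u.1‖ ^ 2 + t * (2 * inner ℝ (g - u.1) h) + t ^ 2 * ‖h‖ ^ 2 := by
    intro t
    simp only [K]
    rw [norm_add_sq_real, real_inner_smul_right, norm_smul, mul_pow, Real.norm_eq_abs, sq_abs]
    ring
  have hd1 : HasDerivAt K (2 * inner ℝ (g - u.1) h) 0 := by
    have h1 : HasDerivAt (fun t : ℝ => ‖g - u.1‖ ^ 2 + t * (2 * inner ℝ (g - u.1) h) +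
        t ^ 2 * ‖h‖ ^ 2) (2 * inner ℝ (g - u.1) h) 0 := by
      refine ((((hasDerivAt_id (0 : ℝ)).mul_const (2 * inner ℝ (g - u.1) h)).const_add
        (‖g - u.1‖ ^ 2)).add ((hasDerivAt_pow 2 (0 : ℝ)).mul_const (‖h‖ ^ 2))).congr_deriv ?_
      simp
    exact h1.congr_of_eventuallyEq (Eventually.of_forall hK)
  have hd2 : HasDerivAt K (inner ℝ G δ) 0 := by
    rw [hasDerivAt_iff_isLittleO]
    have ht : Tendsto (fun t : ℝ => t • δ') (𝓝 0) (𝓝 0) := by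
      have : Continuous fun t : ℝ => t • δ' := by fun_prop
      simpa only [zero_smul] using! this.tendsto 0
    have h1 := Asymptotics.IsLittleO.comp_tendsto hG ht
    refine (h1.congr_left fun t => ?_).trans_isBigO ?_
    · simp only [Function.comp_apply]
      rw [hJ, hJ0]
      change _ - _ - inner ℝ G (t • δ) = _
      simp only [K, zero_smul, add_zero, sub_zero, smul_eq_mul]
      rw [real_inner_smul_right]
    · refine Asymptotics.IsBigO.of_bound ‖δ‖ (Eventually.of_forall fun t => ?_)
      simp only [Function.comp_apply, sub_zero, norm_norm]
      change ‖t • δ‖ ≤ _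
      rw [norm_smul, mul_comm]
  exact hd2.unique hd1

/-- The Dirichlet form of `v'` and `w` is computed twice: by Green's formula for `v'`, and by the
weak equation for `w` tested with `v'`, which gives zero because `w` has no outer flux and `v'` no
inner trace. -/
theorem IsAdjointGradient.inner_eq {a b : ℝ} (ha : 0 < a) (hab : a < b) {u : HalfOuter a b}
    {q : HalfOuter a b →ₗ[ℝ] ℝ} {ω : HalfInner a b} {G : L2 (arcMeasure a)}
    (hG : IsAdjointGradient u q ω G) {v w : H1 (annulus a b)} {g h : L2 (arcMeasure b)}
    {δ : L2 (arcMeasure a)} (hv : IsPrimarySolution q ω.1 v g)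
    (hw : IsPrimarySolution (0 : HalfOuter a b →ₗ[ℝ] ℝ) δ w h) :
    inner ℝ G δ = 2 * inner ℝ (g - u.1) h := by
  obtain ⟨v₁, g₁, v', h1, ⟨⟨γ, h2⟩, -⟩, h3⟩ := hG
  obtain rfl := hv.outer_unique ha hab h1
  have e1 := h3 w δ h hw.1
  have e2 := hw.2 v' γ h2
  rw [dirichletForm_comm, LinearMap.zero_apply] at e2
  rw [e2, real_inner_smul_left, inner_neg_left] at e1
  linarith

/-! ### The gradient on finite Fourier sums -/

/-- The factor `2` comes from differentiating a square, `a` and `b` from the arc lengths of the two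
circles, and the squared transfer coefficient from one passage to the outer circle and one back. -/
theorem coeffC_eq {a b : ℝ} (ha : 0 < a) (hb : 0 < b) (j : ℤ) :
    coeffC a b j * a = 2 * b * transferCoeff a b j.natAbs ^ 2 := by
  have hj : 2 * |j| = ((2 * j.natAbs : ℕ) : ℤ) := by push_cast; rfl
  rw [coeffC, hj, zpow_add₀ hb.ne', zpow_sub₀ ha.ne', zpow_natCast, zpow_natCast, zpow_one, zpow_one,
    transferCoeff, div_pow (b ^ 2), ← pow_mul, pow_mul', pow_mul']
  have h1 : 0 < a ^ j.natAbs := pow_pos ha _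
  have h2 : 0 < b ^ j.natAbs := pow_pos hb _
  generalize a ^ j.natAbs = x at *
  generalize b ^ j.natAbs = y at *
  have h3 : 0 < x ^ 2 + y ^ 2 := by positivity
  field_simp
  ring

theorem coeffC_pos {a b : ℝ} (ha : 0 < a) (hb : 0 < b) (j : ℤ) : 0 < coeffC a b j := by
  unfold coeffC; positivity

theorem coeffC_abs (a b : ℝ) (j : ℤ) : coeffC a b |j| = coeffC a b j := by
  simp only [coeffC, abs_abs]

/-- A finite Fourier series with real values is a finite sum of modes. -/
theorem HasFiniteFourier.exists_sum {R : ℝ} (hR : 0 < R) {M N : ℕ} {f : L2 (arcMeasure R)}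
    (h : HasFiniteFourier R M N f) :
    ∃ d : ℤ → ℂ, f = ∑ j ∈ (Finset.Icc (-(N : ℤ)) N).filter (fun j => (M : ℤ) ≤ |j|),
      circleMode R j.natAbs (d j) := by
  obtain ⟨c, hc⟩ := h
  choose d hd using fun j : ℤ => exists_phase_eq j (c j)
  refine ⟨d, ?_⟩
  set S := (Finset.Icc (-(N : ℤ)) N).filter (fun j => (M : ℤ) ≤ |j|)
  have hcont : Continuous fun p => ∑ j ∈ S, circleModeFun R j.natAbs (d j) p :=
    continuous_finsetSum _ fun j _ => continuous_circleModeFun R j.natAbs (d j)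
  have h1 : f =ᵐ[arcMeasure R] fun p => ∑ j ∈ S, circleModeFun R j.natAbs (d j) p := by
    refine ae_eq_arcMeasure_of_circlePoint hR f hcont ?_
    filter_upwards [hc] with θ hθ
    -- The left side is real, so real parts may be taken term by term; no conjugate symmetry of the
    -- coefficients is required.
    have h2 := congrArg Complex.re hθ
    rw [Complex.ofReal_re, Complex.re_sum] at h2
    rw [h2]
    exact Finset.sum_congr rfl fun j _ => by rw [hd, circleModeFun_circlePoint hR.ne']
  refine Lp.ext (h1.trans ?_)
  have h3 : ∀ᵐ p ∂arcMeasure R, ∀ j ∈ S,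
      circleMode R j.natAbs (d j) p = circleModeFun R j.natAbs (d j) p :=
    (ae_ball_iff S.countable_toSet).2 fun j _ => coeFn_circleMode R j.natAbs (d j)
  filter_upwards [h3, Lp.coeFn_finsetSum S fun j => circleMode R j.natAbs (d j)] with p hp hs
  rw [hs, Finset.sum_apply]
  exact Finset.sum_congr rfl fun j hj => (hp j hj).symm

/-- The real factors `t` are kept apart from the amplitudes `d`, because the iteration changes only
the former. -/
theorem exists_isPrimarySolution_sum {a b : ℝ} (ha : 0 < a) (hab : a < b) (S : Finset ℤ)
    (d : ℤ → ℂ) (t : ℤ → ℝ) :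
    ∃ v : H1 (annulus a b), IsPrimarySolution (0 : HalfOuter a b →ₗ[ℝ] ℝ)
      (∑ j ∈ S, t j • circleMode a j.natAbs (d j)) v
      (∑ j ∈ S, t j • transferCoeff a b j.natAbs • circleMode b j.natAbs (d j)) := by
  classical
  induction S using Finset.induction_on with
  | empty => exact ⟨0, HasTrace.zero a b, fun φ γ _ => by simp [dirichletForm]⟩
  | insert i S hi ih =>
    obtain ⟨v, hv⟩ := ih
    obtain ⟨w, hw⟩ := exists_isPrimarySolution_mode ha hab i.natAbs (d i)
    refine ⟨v + t i • w, ?_⟩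
    rw [Finset.sum_insert hi, Finset.sum_insert hi, add_comm, add_comm (t i • _ • _)]
    have h := hv.add_smul (t i) hw
    rwa [smul_zero, add_zero] at h

/-- The gradient of the cost at a boundary value that differs from the exact one by a finite sum of
modes: the mode `j` is multiplied by `C_j`. -/
theorem gradient_eq {a b : ℝ} (ha : 0 < a) (hab : a < b) {u : HalfOuter a b}
    {q : HalfOuter a b →ₗ[ℝ] ℝ} (hdata : IsCauchyData u q) {ωstar ω : HalfInner a b}
    (hstar : costJ u q ωstar = ⨅ ω : HalfInner a b, costJ u q ω) {G : L2 (arcMeasure a)}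
    (hG : IsFirstVariation u q ω G ∨ IsAdjointGradient u q ω G) {S : Finset ℤ} {d : ℤ → ℂ}
    {t : ℤ → ℝ} (hω : (ωstar : L2 (arcMeasure a)) - (ω : L2 (arcMeasure a)) =
      ∑ j ∈ S, t j • circleMode a j.natAbs (d j)) :
    G = -∑ j ∈ S, (coeffC a b j * t j) • circleMode a j.natAbs (d j) := by
  have hb := ha.trans hab
  obtain ⟨v, hv⟩ := exists_primary_of_minimizer ha hab hdata hstar
  obtain ⟨w, hw⟩ := exists_isPrimarySolution_sum ha hab S d t
  -- The solution at `ω` is the one at `ωstar` minus the explicit zero-flux solution with inner data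
  -- `ωstar - ω`.
  have hsol := hv.add_smul (-1) hw
  rw [← hω, smul_zero, add_zero, neg_one_smul ℝ ((ωstar : L2 (arcMeasure a)) - ω), neg_sub,
    add_sub_cancel] at hsol
  have key : ∀ n c, inner ℝ G (circleMode a n c) =
      -(2 * ∑ j ∈ S, t j * (transferCoeff a b j.natAbs * (transferCoeff a b n *
        inner ℝ (circleMode b j.natAbs (d j)) (circleMode b n c)))) := by
    intro n c
    obtain ⟨z, hz⟩ := exists_isPrimarySolution_mode ha hab n c
    have h : inner ℝ G (circleMode a n c) = 2 * inner ℝ _ _ :=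
      hG.elim (fun h => h.inner_eq ha hab hsol hz) (fun h => h.inner_eq ha hab hsol hz)
    rw [h, add_sub_cancel_left, real_inner_smul_left, sum_inner, neg_one_mul, mul_neg]
    congr 2
    refine Finset.sum_congr rfl fun j _ => ?_
    rw [real_inner_smul_left, real_inner_smul_left, real_inner_smul_right]
  rw [← sub_eq_zero, sub_neg_eq_add]
  refine eq_zero_of_inner_circleMode ha _ fun n c => ?_
  rw [inner_add_left, key, sum_inner, Finset.mul_sum, ← Finset.sum_neg_distrib,
    ← Finset.sum_add_distrib]
  refine Finset.sum_eq_zero fun j _ => ?_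
  rw [real_inner_smul_left]
  -- Modes of equal frequency need not be orthogonal, but their angular integral is the same on both
  -- circles, so `coeffC_eq` settles this case; modes of different frequencies are orthogonal on
  -- both circles.
  by_cases hj : j.natAbs = n
  · subst hj
    rw [inner_circleMode_circleMode ha, inner_circleMode_circleMode hb]
    linear_combination (t j * ∫ θ in (-Real.pi)..Real.pi,
      phase j.natAbs (d j) θ * phase j.natAbs c θ) * coeffC_eq ha hb j
  · rw [inner_circleMode_of_ne ha hj, inner_circleMode_of_ne hb hj]
    ring

end AnnulusCauchy

/-! ### The iteration -/

theorem theorem2 (a b : ℝ) (ha : 0 < a) (hab : a < b)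
    (u : HalfOuter a b) (q : HalfOuter a b →ₗ[ℝ] ℝ) (hdata : IsCauchyData u q)
    (ωstar : HalfInner a b) (hstar : costJ u q ωstar = ⨅ ω : HalfInner a b, costJ u q ω)
    (M N : ℕ) (hMN : M ≤ N)
    (ω : ℕ → HalfInner a b) (μ : ℕ → HalfInner a b) (hμ : ∀ k, μ k = ωstar - ω k)
    (G : ℕ → L2 (arcMeasure a)) (ρ : ℕ → ℝ)
    (hG : ∀ k ≤ N - M, IsFirstVariation u q (ω k) (G k) ∨ IsAdjointGradient u q (ω k) (G k))
    (hstep : ∀ k ≤ N - M,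
      (ω (k + 1) : L2 (arcMeasure a)) = (ω k : L2 (arcMeasure a)) - ρ k • G k)
    (hfourier : HasFiniteFourier a M N (μ 0))
    (hρ : (∀ k ≤ N - M, ρ k = 1 / coeffC a b ((M : ℤ) + k)) ∨
      (∀ k ≤ N - M, ρ k = 1 / coeffC a b ((N : ℤ) - k))) :
    μ (N - M + 1) = 0 ∧ ω (N - M + 1) = ωstar := by
  have hb := ha.trans hab
  obtain ⟨d, hd⟩ := hfourier.exists_sum ha
  set S := (Finset.Icc (-(N : ℤ)) N).filter (fun j => (M : ℤ) ≤ |j|) with hS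
  have hsub : ∀ k, (μ k : L2 (arcMeasure a)) = (ωstar : L2 (arcMeasure a)) - ω k := fun k => by
    rw [hμ k]; rfl
  -- Each step contributes one factor `1 - ρ i * C_j` to the term `j`. The range reaches `N - M +
  -- 1`, so the final product contains every index `i ≤ N - M`.
  have hind : ∀ k ≤ N - M + 1, (μ k : L2 (arcMeasure a)) =
      ∑ j ∈ S, (∏ i ∈ Finset.range k, (1 - ρ i * coeffC a b j)) •
        circleMode a j.natAbs (d j) := by
    intro k
    induction k with
    | zero => intro _; simpa using hd
    | succ k ih =>
      intro hk
      have hk' : k ≤ N - M := by omega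
      have h1 := ih (by omega)
      have hgrad := gradient_eq ha hab hdata hstar (hG k hk') ((hsub k).symm.trans h1)
      rw [hsub, hstep k hk', ← sub_add, ← hsub, h1, hgrad, smul_neg, Finset.smul_sum,
        ← Finset.sum_neg_distrib, ← Finset.sum_add_distrib]
      refine Finset.sum_congr rfl fun j _ => ?_
      rw [Finset.prod_range_succ, smul_smul, ← neg_smul, ← add_smul]
      congr 1
      ring
  have hzero : (μ (N - M + 1) : L2 (arcMeasure a)) = 0 := by
    rw [hind _ le_rfl]
    refine Finset.sum_eq_zero fun j hj => ?_
    rw [hS, Finset.mem_filter, Finset.mem_Icc] at hj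
    have hjN : |j| ≤ N := abs_le.2 hj.1
    have hjM := hj.2
    -- The step that annihilates the term `j` is `|j| - M` for the increasing choice and `N - |j|`
    -- for the decreasing one; `M ≤ |j| ≤ N` puts both in range.
    obtain ⟨i, hi, hρi⟩ : ∃ i ≤ N - M, ρ i = 1 / coeffC a b |j| := by
      obtain h | h := hρ
      · refine ⟨(|j| - M).toNat, by omega, ?_⟩
        rw [h _ (by omega)]
        congr 2
        omega
      · refine ⟨(N - |j|).toNat, by omega, ?_⟩
        rw [h _ (by omega)]
        congr 2
        omega
    rw [Finset.prod_eq_zero (Finset.mem_range.2 (Nat.lt_succ_of_le hi)), zero_smul]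
    rw [hρi, coeffC_abs, one_div_mul_cancel (coeffC_pos ha hb j).ne', sub_self]
  have hμ0 : μ (N - M + 1) = 0 := Subtype.ext hzero
  refine ⟨hμ0, ?_⟩
  rw [hμ] at hμ0
  exact (sub_eq_zero.1 hμ0).symm
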